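/- For $k,l\ge 0$ let $\Gamma_{k,l}$ be the join of the complete graph on $k$ nodes and the graph on $l$ nodes without edges (so two of the $k+l$ nodes are adjacent unless both are among the last $l$), and let $P_{k,l}=\sum_S \Delta_S\subset\mathbb R^{k+l}$ be its nestohedron: the Minkowski sum, over all nonempty node sets $S$ that induce a connected subgraph of $\Gamma_{k,l}$, of the simplices $\Delta_S=\operatorname{conv}\{e_i : i\in S\}$. For an $n$-dimensional simple polytope $P$ with $f_i$ faces of dimension $i$ put $$f(P)(\alpha,t)=\sum_{i=0}^{n} f_i\,\alpha^{i}t^{\,n-i}\quad(f_n=1),\qquad h(P)(\alpha,t)=f(P)(\alpha-t,t);$$ the $\gamma$-vector $(\gamma_0,\dots,\gamma_{\lfloor n/2\rfloor})$ of $P$ is defined by $h(P)(\alpha,t)=\sum_{i}\gamma_i\,(\alpha t)^i(\alpha+t)^{n-2i}$. A series $\psi\in\mathbb Q[\alpha,t][[x,y]]$ is called a Gal series if (1) $\psi(\alpha,t,x,y)=\psi(t,\alpha,x,y)$, so that $\psi=\hat\psi(\alpha+t,\alpha t,x,y)$ for a unique $\hat\psi\in\mathbb Q[a,b][[x,y]]$;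 (2) $\psi$ is homogeneous for the grading $\deg\alpha=\deg t=-2$, $\deg x=\deg y=2$; (3) all coefficients of $\hat\psi(a,b,x,y)$ are non-negative. **Theorem.** The series $$P_{h,\nabla,\because}(\alpha,t,x,y)=\sum_{k\ge 1}\sum_{l\ge 0} h(P_{k,l})(\alpha,t)\,\frac{x^k}{k!}\frac{y^l}{l!}$$ is a Gal series. Moreover, for all $k,l\ge 0$ the polytope $P_{k,l}$ has a $\gamma$-vector, with integral entries, and all entries are non-negative. (For $k=0$ the polytope is a single point.) -/

import Mathlib

open scoped Pointwise

/-! ### Building sets and nestohedra -/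

/-- A building set on a finite ground set `V`: a collection of nonempty subsets of `V` which
contains all singletons and is closed under unions of intersecting members. -/
structure BuildingSet (V : Type) [DecidableEq V] where
  sets : Finset (Finset V)
  nonempty_of_mem : ∀ S ∈ sets, S.Nonempty
  singleton_mem : ∀ v : V, {v} ∈ sets
  union_mem : ∀ S ∈ sets, ∀ T ∈ sets, (S ∩ T).Nonempty → S ∪ T ∈ sets

open Classical in
/-- The graphical building set of `G`: all nonempty vertex sets inducing a connected subgraph. -/
noncomputable def SimpleGraph.buildingSet {V : Type} [Fintype V] [DecidableEq V] (G : SimpleGraph V) :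
    BuildingSet V where
  sets := Finset.univ.filter fun S : Finset V => S.Nonempty ∧ (G.induce (S : Set V)).Connected
  nonempty_of_mem S hS := (Finset.mem_filter.1 hS).2.1
  singleton_mem v := by
    refine Finset.mem_filter.2 ⟨Finset.mem_univ _, Finset.singleton_nonempty v, ?_⟩
    rw [Finset.coe_singleton, SimpleGraph.connected_iff]
    refine ⟨?_, ⟨⟨v, rfl⟩⟩⟩
    rintro ⟨a, rfl⟩ ⟨b, rfl⟩
    exact SimpleGraph.Reachable.refl _
  union_mem S hS T hT h := by
    obtain ⟨-, hS1, hS2⟩ := Finset.mem_filter.1 hS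
    obtain ⟨-, -, hT2⟩ := Finset.mem_filter.1 hT
    refine Finset.mem_filter.2 ⟨Finset.mem_univ _, hS1.mono Finset.subset_union_left, ?_⟩
    rw [Finset.coe_union]
    refine SimpleGraph.induce_union_connected hS2.preconnected hT2.preconnected ?_
    rw [← Finset.coe_inter]
    exact h

/-- The simplex `Δ_S`, the convex hull of the standard basis vectors `e_i` with `i ∈ S`. -/
def simplexOn {V : Type} [DecidableEq V] (S : Finset V) : Set (V → ℝ) :=
  convexHull ℝ ((fun i : V => (Pi.single i 1 : V → ℝ)) '' (S : Set V))

/-- The nestohedron of a building set: the Minkowski sum of the simplices `Δ_S`, `S ∈ B`. -/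
noncomputable def nestohedron {V : Type} [DecidableEq V] (B : BuildingSet V) : Set (V → ℝ) :=
  ∑ S ∈ B.sets, simplexOn S

/-! ### The join of a complete graph and an empty graph -/

/-- The join of two graphs: their disjoint union together with all edges between them. -/
def SimpleGraph.joinGraph {V W : Type} (G : SimpleGraph V) (H : SimpleGraph W) :
    SimpleGraph (V ⊕ W) :=
  (G ⊕g H) ⊔ completeBipartiteGraph V W

/-- The nestohedron of the join of the complete graph on `k` nodes and the graph on `l` nodes
without edges. -/
noncomputable def joinNestohedron (k l : ℕ) : Set (Fin k ⊕ Fin l → ℝ) :=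
  nestohedron
    (SimpleGraph.joinGraph (⊤ : SimpleGraph (Fin k)) (⊥ : SimpleGraph (Fin l))).buildingSet

/-! ### `f`-, `h`- and `γ`-polynomials -/

/-- The dimension of a convex set. -/
noncomputable def convDim {V : Type} (P : Set (V → ℝ)) : ℕ :=
  Module.finrank ℝ (vectorSpan ℝ P)

/-- The number of `i`-dimensional faces of the polytope `P`. The (nonempty) faces of a polytope,
the polytope itself included, are its nonempty exposed subsets. -/
noncomputable def faceCount {V : Type} (P : Set (V → ℝ)) (i : ℕ) : ℕ :=
  Set.ncard {F : Set (V → ℝ) | F.Nonempty ∧ IsExposed ℝ P F ∧ convDim F = i}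

/-- Polynomials in the two variables `α = X 0` and `t = X 1`. -/
abbrev AlphaT : Type := MvPolynomial (Fin 2) ℚ

/-- The `f`-polynomial `α ^ n + f_{n-1} α ^ (n-1) t + ⋯ + f_1 α t ^ (n-1) + f_0 t ^ n`. -/
noncomputable def fPoly {V : Type} (P : Set (V → ℝ)) : AlphaT :=
  ∑ i ∈ Finset.range (convDim P + 1),
    MvPolynomial.C (faceCount P i : ℚ) * MvPolynomial.X 0 ^ i *
      MvPolynomial.X 1 ^ (convDim P - i)

/-- The `h`-polynomial `h(α, t) = f(α - t, t)`. -/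
noncomputable def hPoly {V : Type} (P : Set (V → ℝ)) : AlphaT :=
  MvPolynomial.aeval ![(MvPolynomial.X 0 - MvPolynomial.X 1 : AlphaT), MvPolynomial.X 1] (fPoly P)

/-- `γ = (γ_0, …, γ_{⌊n/2⌋})` is the `γ`-vector of the `n`-dimensional polytope `P`:
`h(α, t) = ∑ γ_i (α t) ^ i (α + t) ^ (n - 2 i)`. -/
def IsGammaVector {V : Type} (P : Set (V → ℝ)) (γ : Fin (convDim P / 2 + 1) → ℤ) : Prop :=
  hPoly P = ∑ i : Fin (convDim P / 2 + 1),
    MvPolynomial.C (γ i : ℚ) * (MvPolynomial.X 0 * MvPolynomial.X 1) ^ (i : ℕ) *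
      (MvPolynomial.X 0 + MvPolynomial.X 1) ^ (convDim P - 2 * (i : ℕ))

/-! ### Gal series -/

/-- Formal power series in `x` (index `0`) and `y` (index `1`) over `ℚ[α, t]`. -/
abbrev SeriesXY : Type := MvPowerSeries (Fin 2) AlphaT

/-- `ψ(α, t, x, y) = ψ(t, α, x, y)`. -/
def IsSymmetricSeries (ψ : SeriesXY) : Prop :=
  MvPowerSeries.map (MvPolynomial.rename (R := ℚ) (Equiv.swap (0 : Fin 2) 1)).toRingHom ψ = ψ

/-- Homogeneity for the grading `deg α = deg t = -2`, `deg x = deg y = 2`. -/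
def IsHomogeneousSeries (ψ : SeriesXY) : Prop :=
  ∃ d : ℤ, ∀ m e : Fin 2 →₀ ℕ, MvPolynomial.coeff e (MvPowerSeries.coeff m ψ) ≠ 0 →
    2 * ((m 0 : ℤ) + m 1) - 2 * ((e 0 : ℤ) + e 1) = d

/-- The substitution `a = α + t`, `b = α t` in a series over `ℚ[a, b]`, `a = X 0`, `b = X 1`. -/
noncomputable def substAB (ψ : MvPowerSeries (Fin 2) (MvPolynomial (Fin 2) ℚ)) : SeriesXY :=
  MvPowerSeries.map (MvPolynomial.aeval (R := ℚ)
    ![(MvPolynomial.X 0 + MvPolynomial.X 1 : AlphaT),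
      MvPolynomial.X 0 * MvPolynomial.X 1]).toRingHom ψ

/-- A Gal series: symmetric in `α` and `t`, homogeneous, and with only non-negative coefficients
when written in terms of `a = α + t` and `b = α t`. (As `α + t` and `α t` are algebraically
independent, the series over `ℚ[a, b]` is unique.) -/
def IsGalSeries (ψ : SeriesXY) : Prop :=
  IsSymmetricSeries ψ ∧ IsHomogeneousSeries ψ ∧
    ∃ ψ' : MvPowerSeries (Fin 2) (MvPolynomial (Fin 2) ℚ), substAB ψ' = ψ ∧
      ∀ m e : Fin 2 →₀ ℕ, 0 ≤ MvPolynomial.coeff e (MvPowerSeries.coeff m ψ')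

/-- The generating series `∑_{k ≥ 1} ∑_{l ≥ 0} h(P_{k,l})(α, t) x ^ k / k! * y ^ l / l!`, where
`P_{k,l}` is the nestohedron of the join of the complete graph on `k` nodes and the empty graph
on `l` nodes. -/
noncomputable def joinSeries : SeriesXY := fun m : Fin 2 →₀ ℕ =>
  if 1 ≤ m 0 then
    MvPolynomial.C (1 / ((m 0).factorial * (m 1).factorial : ℚ)) *
      hPoly (joinNestohedron (m 0) (m 1))
  else 0

/-! For k ≥ 1, a node set lies in the building set exactly when it meets the clique K or is a
singleton. The face of P_{k,l} in direction c is the Minkowski sum of the simplices on the sets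
where c is maximal on S. It therefore depends only on the ordered partition that c induces on the
nodes with value at least min c(K); the order among lower nodes is invisible. So faces correspond to
levelings (`faceCount_eq_card`), and the dimension is the number of nodes on positive levels minus
the number of these levels.

Put a = α - t, so that h is the sum of a^dim t^codim over all levelings. Let E(z) = (e^{az} - 1)/a,
with the division by a carried out formally. Splitting off the highest level gives F = E(x)
e^{(a+t)y} + t E(x+y) F for the exponential generating series F, hence F = E(x) e^{(a+t)y} / (1 - t
E(x+y)).

Positivity is read off differential equations. The series H = E/(1 - tE) satisfies H' = 1 + (a+2t) H
+ t(a+t) H², while ∂F/∂y = (a+2t + t(a+t) H(x+y)) F and F(x,0) = H(x). Since a+2t = α+t and t(a+t) =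
αt, only 1, α+t and αt occur as coefficients. Induction on the order
(`mem_hurwitzGrading_of_riccati`, `mem_hurwitzGrading_of_exp_series`) shows that k! l! times each
coefficient of F is a combination of monomials in α+t and αt with coefficients in ℕ. Factorials
never have to be divided out, because coefficients scaled by factorials multiply with binomial
coefficients; this makes γ integral as well as non-negative. -/

/-! ### Power series graded by their factorial-scaled coefficients -/

open scoped Nat in
/-- The power series whose `n`-th coefficient, multiplied by `n!`, lies in `G (n + d)`. -/
def hurwitzGrading {R : Type*} [CommRing R] (G : ℤ → AddSubmonoid R) (d : ℤ) :
    AddSubmonoid (PowerSeries R) where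
  carrier := {ψ | ∀ k : ℕ, ((k ! : ℕ) : R) * PowerSeries.coeff k ψ ∈ G (d + k)}
  zero_mem' k := by simp
  add_mem' h₁ h₂ k := by
    rw [map_add, mul_add]
    exact add_mem (h₁ k) (h₂ k)

section HurwitzGrading

open scoped Nat

variable {R : Type*} [CommRing R]

theorem factorial_mul_coeff_mul (χ ψ : PowerSeries R) (k : ℕ) :
    ((k ! : ℕ) : R) * PowerSeries.coeff k (χ * ψ) =
      ∑ i ∈ Finset.range (k + 1), (k.choose i : R) *
        ((((i ! : ℕ) : R) * PowerSeries.coeff i χ) *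
          ((((k - i) ! : ℕ) : R) * PowerSeries.coeff (k - i) ψ)) := by
  rw [PowerSeries.coeff_mul, Finset.Nat.sum_antidiagonal_eq_sum_range_succ
    (fun i j => PowerSeries.coeff i χ * PowerSeries.coeff j ψ), Finset.mul_sum]
  refine Finset.sum_congr rfl fun i hi => ?_
  rw [← Nat.choose_mul_factorial_mul_factorial (Finset.mem_range_succ_iff.1 hi)]
  push_cast
  ring

variable {G : ℤ → AddSubmonoid R}

theorem factorial_mul_coeff_mul_mem [SetLike.GradedMul G] {χ ψ : PowerSeries R} {d e : ℤ} {k : ℕ}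
    (hχ : ∀ i ≤ k, ((i ! : ℕ) : R) * PowerSeries.coeff i χ ∈ G (d + i))
    (hψ : ∀ i ≤ k, ((i ! : ℕ) : R) * PowerSeries.coeff i ψ ∈ G (e + i)) :
    ((k ! : ℕ) : R) * PowerSeries.coeff k (χ * ψ) ∈ G (d + e + k) := by
  rw [factorial_mul_coeff_mul]
  refine sum_mem fun i hi => ?_
  have hik := Finset.mem_range_succ_iff.1 hi
  rw [← nsmul_eq_mul]
  refine nsmul_mem ?_ _
  have h := SetLike.mul_mem_graded (hχ i hik) (hψ (k - i) (Nat.sub_le _ _))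
  rwa [show d + i + (e + (k - i : ℕ)) = d + e + k by push_cast [hik]; ring] at h

instance [SetLike.GradedMul G] : SetLike.GradedMul (hurwitzGrading G) where
  mul_mem _ _ _ _ hx hy _ :=
    factorial_mul_coeff_mul_mem (fun i _ => hx i) (fun i _ => hy i)

theorem C_mem_hurwitzGrading {d : ℤ} {r : R} (hr : r ∈ G d) :
    PowerSeries.C r ∈ hurwitzGrading G d := by
  intro k
  rw [PowerSeries.coeff_C]
  split_ifs with hk
  · subst hk
    simpa using hr
  · simp

/-- Solutions of a Riccati equation with coefficients in the Hurwitz grading belong to it. -/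
theorem mem_hurwitzGrading_of_riccati [SetLike.GradedMul G] {p q r ψ : PowerSeries R} {d : ℤ}
    (hp : p ∈ hurwitzGrading G (d + 1)) (hq : q ∈ hurwitzGrading G 1)
    (hr : r ∈ hurwitzGrading G (1 - d)) (h0 : PowerSeries.constantCoeff ψ ∈ G d)
    (hψ : PowerSeries.derivative R ψ = p + q * ψ + r * (ψ * ψ)) :
    ψ ∈ hurwitzGrading G d := by
  suffices h : ∀ n : ℕ, ∀ k ≤ n, ((k ! : ℕ) : R) * PowerSeries.coeff k ψ ∈ G (d + k) from
    fun k => h k k le_rfl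
  intro n
  induction n with
  | zero =>
    intro k hk
    obtain rfl : k = 0 := by omega
    simpa using h0
  | succ n ih =>
    intro k hk
    obtain hk | rfl := Nat.le_succ_iff.1 hk
    · exact ih k hk
    have h1 := congrArg (fun ξ => ((n ! : ℕ) : R) * PowerSeries.coeff n ξ) hψ
    simp only [PowerSeries.coeff_derivative, map_add, mul_add] at h1
    have h2 : (((n + 1) ! : ℕ) : R) * PowerSeries.coeff (n + 1) ψ =
        ((n ! : ℕ) : R) * (PowerSeries.coeff (n + 1) ψ * n + PowerSeries.coeff (n + 1) ψ * 1) := by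
      rw [Nat.factorial_succ]
      push_cast
      ring
    -- The equation expresses the coefficient of index n + 1 through those of index at most n. The
    -- degrees of `q` and `r` are chosen so that `q * ψ` and `r * ψ ^ 2` both have degree d + 1,
    -- like `p`.
    rw [Nat.succ_eq_add_one, h2, mul_add, h1,
      show d + ((n + 1 : ℕ) : ℤ) = d + 1 + n by push_cast; ring]
    refine add_mem (add_mem (hp n) ?_) ?_
    · rw [show d + 1 = 1 + d by ring]
      exact factorial_mul_coeff_mul_mem (fun i _ => hq i) ih
    · rw [show d + 1 = (1 - d) + (d + d) by ring]
      refine factorial_mul_coeff_mul_mem (fun i _ => hr i) fun i hi => ?_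
      exact factorial_mul_coeff_mul_mem (fun j hj => ih j (hj.trans hi))
        (fun j hj => ih j (hj.trans hi))

end HurwitzGrading

/-! ### The exponential series and its Riccati equation -/

section ExpSeries

open scoped Nat

variable {R : Type*} [CommRing R] [Algebra ℚ R]

/-- The power series `(exp (a X) - 1) / a`. -/
noncomputable def expSubOneDiv (a : R) : PowerSeries R :=
  PowerSeries.mk fun n => if n = 0 then 0 else algebraMap ℚ R (n ! : ℚ)⁻¹ * a ^ (n - 1)

theorem factorial_mul_algebraMap_inv (n : ℕ) :
    ((n ! : ℕ) : R) * algebraMap ℚ R (n ! : ℚ)⁻¹ = 1 := by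
  rw [← map_natCast (algebraMap ℚ R), ← map_mul, mul_inv_cancel₀ (by positivity), map_one]

theorem factorial_mul_coeff_expSubOneDiv (a : R) (n : ℕ) :
    ((n ! : ℕ) : R) * PowerSeries.coeff n (expSubOneDiv a) = if n = 0 then 0 else a ^ (n - 1) := by
  rw [expSubOneDiv, PowerSeries.coeff_mk]
  split_ifs
  · simp
  · rw [← mul_assoc, factorial_mul_algebraMap_inv, one_mul]

theorem constantCoeff_expSubOneDiv (a : R) : PowerSeries.constantCoeff (expSubOneDiv a) = 0 := by
  rw [← PowerSeries.coeff_zero_eq_constantCoeff_apply, expSubOneDiv, PowerSeries.coeff_mk,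
    if_pos rfl]

theorem factorial_mul_cancel {n : ℕ} {x y : R} (h : ((n ! : ℕ) : R) * x = ((n ! : ℕ) : R) * y) :
    x = y := by
  have := congrArg (algebraMap ℚ R (n ! : ℚ)⁻¹ * ·) h
  simpa only [← mul_assoc, mul_comm (algebraMap ℚ R (n ! : ℚ)⁻¹) (n ! : R),
    factorial_mul_algebraMap_inv, one_mul] using this

theorem factorial_mul_coeff_one_add_expSubOneDiv (a : R) (n : ℕ) :
    ((n ! : ℕ) : R) * PowerSeries.coeff n (1 + PowerSeries.C a * expSubOneDiv a) = a ^ n := by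
  rw [map_add, mul_add, PowerSeries.coeff_C_mul, mul_left_comm, factorial_mul_coeff_expSubOneDiv,
    PowerSeries.coeff_one]
  obtain rfl | n := n
  · simp
  · simp [pow_succ']

theorem derivative_expSubOneDiv (a : R) :
    PowerSeries.derivative R (expSubOneDiv a) = 1 + PowerSeries.C a * expSubOneDiv a := by
  ext n
  refine factorial_mul_cancel (n := n) ?_
  rw [factorial_mul_coeff_one_add_expSubOneDiv, PowerSeries.coeff_derivative, mul_comm (PowerSeries.coeff _ _), ← mul_assoc]
  have := factorial_mul_coeff_expSubOneDiv a (n + 1)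
  rw [Nat.factorial_succ, mul_comm (n + 1)] at this
  simpa using this

end ExpSeries

/-- `E Q` solves a Riccati equation when `E' = 1 + a E` and `Q = 1 / (1 - t E)`. -/
theorem derivative_mul_of_mul_one_sub_eq_one {R : Type*} [CommRing R] {a t : R} {E Q : PowerSeries R}
    (hE : PowerSeries.derivative R E = 1 + PowerSeries.C a * E)
    (hQ : Q * (1 - PowerSeries.C t * E) = 1) :
    PowerSeries.derivative R Q = PowerSeries.C t * (1 + PowerSeries.C a * E) * (Q * Q) ∧
    PowerSeries.derivative R (E * Q) = 1 + PowerSeries.C (a + 2 * t) * (E * Q) +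
      PowerSeries.C (t * (a + t)) * (E * Q * (E * Q)) := by
  have h1 : PowerSeries.derivative R Q =
      PowerSeries.C t * (1 + PowerSeries.C a * E) * (Q * Q) := by
    have h := congrArg (PowerSeries.derivative R) hQ
    simp only [Derivation.leibniz, smul_eq_mul, map_sub, hE, Derivation.map_one_eq_zero,
      PowerSeries.derivative_C] at h
    -- Differentiating `hQ` gives Q'(1 - tE) = t E' Q; multiplication by Q turns the factor 1 - tE
    -- into 1.
    linear_combination (-PowerSeries.derivative R Q) * hQ + Q * h
  refine ⟨h1, ?_⟩
  rw [Derivation.leibniz, h1, hE, smul_eq_mul, smul_eq_mul]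
  simp only [map_add, map_mul, map_ofNat]
  set A : PowerSeries R := PowerSeries.C a
  set T : PowerSeries R := PowerSeries.C t
  linear_combination (1 + T * E * Q) * hQ

/-! ### The Gal cone and positivity of the generating series -/

/-- The `ℕ`-combinations of the monomials `a ^ i * b ^ j` with `i + 2 * j = n`. -/
def galCone {R : Type*} [CommRing R] (a b : R) (n : ℤ) : AddSubmonoid R :=
  AddSubmonoid.closure {x | ∃ i j : ℕ, (i : ℤ) + 2 * j = n ∧ x = a ^ i * b ^ j}

section GalCone

open scoped Nat

variable {R : Type*} [CommRing R]

theorem pow_mul_pow_mem_galCone (a b : R) (i j : ℕ) : a ^ i * b ^ j ∈ galCone a b (i + 2 * j) :=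
  AddSubmonoid.subset_closure ⟨i, j, rfl, rfl⟩

instance (a b : R) : SetLike.GradedMul (galCone a b) where
  mul_mem m n x y hx hy := by
    induction hx using AddSubmonoid.closure_induction with
    | zero => simp
    | add x₁ x₂ _ _ h₁ h₂ => rw [add_mul]; exact add_mem h₁ h₂
    | mem x hx =>
      obtain ⟨i, j, rfl, rfl⟩ := hx
      induction hy using AddSubmonoid.closure_induction with
      | zero => simp
      | add y₁ y₂ _ _ h₁ h₂ => rw [mul_add]; exact add_mem h₁ h₂
      | mem y hy =>
        obtain ⟨i', j', rfl, rfl⟩ := hy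
        refine AddSubmonoid.subset_closure ⟨i + i', j + j', by push_cast; ring, by ring⟩

/-- The coefficient of `x ^ k / k! * y ^ l / l!` in a series in `y` over the series in `x`. -/
noncomputable def dividedCoeff (k l : ℕ) (ψ : PowerSeries (PowerSeries R)) : R :=
  ((k ! : ℕ) : R) * PowerSeries.coeff k (((l ! : ℕ) : PowerSeries R) * PowerSeries.coeff l ψ)

theorem dividedCoeff_add (k l : ℕ) (χ ψ : PowerSeries (PowerSeries R)) :
    dividedCoeff k l (χ + ψ) = dividedCoeff k l χ + dividedCoeff k l ψ := by
  simp only [dividedCoeff, map_add, mul_add]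

theorem dividedCoeff_C_C_mul (k l : ℕ) (r : R) (ψ : PowerSeries (PowerSeries R)) :
    dividedCoeff k l (PowerSeries.C (PowerSeries.C r) * ψ) = r * dividedCoeff k l ψ := by
  simp only [dividedCoeff, PowerSeries.coeff_C_mul, mul_left_comm _ (PowerSeries.C r)]
  ring

theorem dividedCoeff_mul (k l : ℕ) (χ ψ : PowerSeries (PowerSeries R)) :
    dividedCoeff k l (χ * ψ) = ∑ i ∈ Finset.range (k + 1), ∑ j ∈ Finset.range (l + 1),
      (k.choose i * l.choose j : R) * (dividedCoeff i j χ * dividedCoeff (k - i) (l - j) ψ) := by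
  rw [dividedCoeff, factorial_mul_coeff_mul χ ψ, map_sum, Finset.mul_sum, Finset.sum_comm]
  refine Finset.sum_congr rfl fun j _ => ?_
  rw [← nsmul_eq_mul (l.choose j), map_nsmul, nsmul_eq_mul (l.choose j), mul_left_comm, factorial_mul_coeff_mul,
    Finset.mul_sum]
  refine Finset.sum_congr rfl fun i _ => ?_
  rw [dividedCoeff, dividedCoeff]
  ring

variable [Algebra ℚ R]

/-- The series is E(x) + e^{ax} E(y) = E(x + y), which is why only k + l matters. -/
theorem dividedCoeff_exp_series (a : R) (k l : ℕ) :
    dividedCoeff k l (PowerSeries.C (expSubOneDiv a) +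
      PowerSeries.C (1 + PowerSeries.C a * expSubOneDiv a) * expSubOneDiv (PowerSeries.C a)) =
      if k + l = 0 then 0 else a ^ (k + l - 1) := by
  rw [dividedCoeff, map_add, PowerSeries.coeff_C_mul, mul_add, mul_left_comm,
    factorial_mul_coeff_expSubOneDiv, PowerSeries.coeff_C]
  obtain rfl | l := l
  · simpa using factorial_mul_coeff_expSubOneDiv a k
  · simp only [Nat.add_eq_zero_iff, one_ne_zero, and_false, if_false, mul_zero, zero_add]
    rw [Nat.add_sub_cancel, ← map_pow, mul_comm (1 + _), PowerSeries.coeff_C_mul, mul_left_comm,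
      factorial_mul_coeff_one_add_expSubOneDiv, ← pow_add, ← add_assoc, Nat.add_sub_cancel,
      add_comm l k]

theorem dividedCoeff_C_mul_exp (a c : R) (k l : ℕ) :
    dividedCoeff k l (PowerSeries.C (expSubOneDiv a) *
      (1 + PowerSeries.C (PowerSeries.C c) * expSubOneDiv (PowerSeries.C c))) =
      if k = 0 then 0 else a ^ (k - 1) * c ^ l := by
  rw [dividedCoeff, PowerSeries.coeff_C_mul, mul_left_comm,
    factorial_mul_coeff_one_add_expSubOneDiv, ← map_pow, mul_comm (expSubOneDiv a), PowerSeries.coeff_C_mul,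
    mul_left_comm, factorial_mul_coeff_expSubOneDiv]
  split_ifs
  · simp
  · ring

/-- Positivity of the series obtained by adjoining one variable to `E₁`, where
`E₁ = (exp (a x) - 1) / a`. -/
theorem mem_hurwitzGrading_of_exp_series {a t E₁ Q₁ : R} {G : ℤ → AddSubmonoid R}
    [SetLike.GradedMul G] (h1 : 1 ∈ G 0) (ha : a + 2 * t ∈ G 1) (hb : t * (a + t) ∈ G 2)
    (hQ₁ : Q₁ * (1 - t * E₁) = 1) (hE₁ : E₁ * Q₁ ∈ G (-1)) {E₂ e Q : PowerSeries R}
    (hE₂ : E₂ = PowerSeries.C E₁ + PowerSeries.C (1 + a * E₁) * expSubOneDiv a)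
    (he : e = 1 + PowerSeries.C (a + t) * expSubOneDiv (a + t))
    (hQ : Q * (1 - PowerSeries.C t * E₂) = 1) :
    E₂ * Q ∈ hurwitzGrading G (-1) ∧ PowerSeries.C E₁ * e * Q ∈ hurwitzGrading G (-1) := by
  have hE₂0 : PowerSeries.constantCoeff E₂ = E₁ := by
    simp [hE₂, constantCoeff_expSubOneDiv]
  have he0 : PowerSeries.constantCoeff e = 1 := by
    simp [he, constantCoeff_expSubOneDiv]
  have hQ0 : PowerSeries.constantCoeff Q = Q₁ := by
    have h := congrArg PowerSeries.constantCoeff hQ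
    rw [map_mul, map_sub, map_mul, PowerSeries.constantCoeff_C, map_one, hE₂0] at h
    linear_combination Q₁ * h - PowerSeries.constantCoeff Q * hQ₁
  have hE₂d : PowerSeries.derivative _ E₂ = 1 + PowerSeries.C a * E₂ := by
    simp only [hE₂, map_add, Derivation.leibniz, smul_eq_mul, PowerSeries.derivative_C,
      derivative_expSubOneDiv, map_one, map_mul, mul_zero, Derivation.map_one_eq_zero]
    ring
  have hed : PowerSeries.derivative _ e = PowerSeries.C (a + t) * e := by
    rw [he, map_add, Derivation.leibniz, derivative_expSubOneDiv, PowerSeries.derivative_C,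
      Derivation.map_one_eq_zero, smul_eq_mul, smul_eq_mul]
    ring
  obtain ⟨hQd, hHd⟩ := derivative_mul_of_mul_one_sub_eq_one hE₂d hQ
  have hH : E₂ * Q ∈ hurwitzGrading G (-1) := by
    refine mem_hurwitzGrading_of_riccati (p := PowerSeries.C 1) (C_mem_hurwitzGrading h1)
      (C_mem_hurwitzGrading ha) (C_mem_hurwitzGrading hb) ?_ (by rw [hHd, map_one])
    rwa [map_mul, hE₂0, hQ0]
  -- Because Q = 1 + t E₂ Q, the logarithmic derivative of e Q is (a + t) + t (1 + a E₂) Q = (a +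
  -- 2t) + t (a + t) E₂ Q. The equation is thus linear, with a coefficient controlled by `hH`, and
  -- the initial value is E₁ Q₁.
  refine ⟨hH, mem_hurwitzGrading_of_riccati (p := 0) (r := 0)
    (q := PowerSeries.C (a + 2 * t) + PowerSeries.C (t * (a + t)) * (E₂ * Q)) (zero_mem _)
    (add_mem (C_mem_hurwitzGrading ha) ?_) (zero_mem _) ?_ ?_⟩
  · exact SetLike.mul_mem_graded (i := 2) (j := -1) (C_mem_hurwitzGrading hb) hH
  · rwa [map_mul, map_mul, he0, PowerSeries.constantCoeff_C, mul_one, hQ0]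
  · rw [Derivation.leibniz, Derivation.leibniz, PowerSeries.derivative_C, hQd, hed]
    simp only [smul_eq_mul, map_add, map_mul, map_ofNat]
    linear_combination (PowerSeries.C t * PowerSeries.C E₁ * e * Q) * hQ

/-- The double sequence defined by a linear recursion, the coefficients of
`exp ((a + t) y) (exp (a x) - 1) / (a + t - t exp (a (x + y)))`, lies in a Gal cone. -/
theorem exists_seq_mem_galCone (a t : R) : ∃ f : ℕ → ℕ → R,
    (∀ k l : ℕ, f k l ∈ galCone (a + 2 * t) (t * (a + t)) (k + l - 1)) ∧
    ∀ k l : ℕ, f k l = (if k = 0 then 0 else a ^ (k - 1) * (a + t) ^ l) +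
      t * ∑ i ∈ Finset.range (k + 1), ∑ j ∈ Finset.range (l + 1),
        (k.choose i * l.choose j : R) *
          ((if i + j = 0 then 0 else a ^ (i + j - 1)) * f (k - i) (l - j)) := by
  have one_mem : (1 : R) ∈ galCone (a + 2 * t) (t * (a + t)) 0 := by
    simpa using pow_mul_pow_mem_galCone (a + 2 * t) (t * (a + t)) 0 0
  have a_mem : a + 2 * t ∈ galCone (a + 2 * t) (t * (a + t)) 1 := by
    simpa using pow_mul_pow_mem_galCone (a + 2 * t) (t * (a + t)) 1 0
  have b_mem : t * (a + t) ∈ galCone (a + 2 * t) (t * (a + t)) 2 := by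
    simpa using pow_mul_pow_mem_galCone (a + 2 * t) (t * (a + t)) 0 1
  have unit₁ : IsUnit (1 - PowerSeries.C t * expSubOneDiv a) := by
    rw [PowerSeries.isUnit_iff_constantCoeff]
    simp [constantCoeff_expSubOneDiv]
  obtain ⟨Q₁, hQ₁⟩ := unit₁.exists_left_inv
  -- The variable x is adjoined first, starting from E₁ = 0: the cone in degree -1 contains only 0.
  have hH₁ := (mem_hurwitzGrading_of_exp_series (E₁ := 0) (Q₁ := 1) one_mem a_mem b_mem (by simp)
    (by simp) (E₂ := expSubOneDiv a) (by simp) rfl hQ₁).1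
  have unit₂ : IsUnit (1 - PowerSeries.C (PowerSeries.C t) * (PowerSeries.C (expSubOneDiv a) +
      PowerSeries.C (1 + PowerSeries.C a * expSubOneDiv a) * expSubOneDiv (PowerSeries.C a))) := by
    rw [PowerSeries.isUnit_iff_constantCoeff]
    simpa [constantCoeff_expSubOneDiv] using unit₁
  obtain ⟨Q, hQ⟩ := unit₂.exists_left_inv
  -- The variable y is adjoined over the series in x; the required initial value H(x) is provided by
  -- `hH₁`.
  have hF := (mem_hurwitzGrading_of_exp_series (a := PowerSeries.C a) (t := PowerSeries.C t)
    (C_mem_hurwitzGrading one_mem)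
    (by simpa only [map_add, map_mul, map_ofNat] using C_mem_hurwitzGrading a_mem)
    (by simpa only [map_add, map_mul] using C_mem_hurwitzGrading b_mem) hQ₁ hH₁ rfl rfl hQ).2
  rw [← map_add PowerSeries.C] at hF
  -- This is 1/(1 - tE) = 1 + tE/(1 - tE), the source of the linear recursion.
  have hrec : ∀ C e t E : PowerSeries (PowerSeries R), Q * (1 - t * E) = 1 →
      C * e * Q = C * e + t * (E * (C * e * Q)) := fun C e t E h => by
    linear_combination (C * e) * h
  have hF' := hrec (PowerSeries.C (expSubOneDiv a)) (1 + PowerSeries.C (PowerSeries.C (a + t)) *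
    expSubOneDiv (PowerSeries.C (a + t))) _ _ hQ
  generalize PowerSeries.C _ * _ * Q = F at hF hF'
  refine ⟨fun k l => dividedCoeff k l F, fun k l => ?_, fun k l => ?_⟩
  · have := hF l k
    rwa [show (-1 : ℤ) + l + k = k + l - 1 by ring] at this
  · beta_reduce
    conv_lhs => rw [hF']
    rw [dividedCoeff_add, dividedCoeff_C_C_mul, dividedCoeff_C_mul_exp, dividedCoeff_mul]
    simp only [dividedCoeff_exp_series]

end GalCone

/-! ### Levelings and the recursion for their weights -/

section Levelings

variable {V : Type} [Fintype V] [DecidableEq V]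

/-- A leveling of `W` relative to `K` puts some elements of `W`, all elements of `K ∩ W` among
them, on the levels `1, …, r`, none of which is empty, so that the first one meets `K`; the
remaining elements of `W` and the elements outside `W` are on level `0`. -/
structure IsLeveling (K W : Finset V) (g : V → ℕ) : Prop where
  eq_zero : ∀ v ∉ W, g v = 0
  ne_zero : ∀ v ∈ K, v ∈ W → g v ≠ 0
  exists_eq_one : ∃ v ∈ K, g v = 1
  exists_eq : ∀ v n, 1 ≤ n → n ≤ g v → ∃ w, g w = n

/-- The highest level. -/
def height (g : V → ℕ) : ℕ := Finset.univ.sup g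

/-- The elements on positive levels. -/
def levelSupport (g : V → ℕ) : Finset V := Finset.univ.filter fun v => g v ≠ 0

omit [DecidableEq V] in
theorem le_height (g : V → ℕ) (v : V) : g v ≤ height g := Finset.le_sup (Finset.mem_univ v)

omit [DecidableEq V] in
@[simp] theorem mem_levelSupport {g : V → ℕ} {v : V} : v ∈ levelSupport g ↔ g v ≠ 0 := by
  simp [levelSupport]

namespace IsLeveling

variable {K W : Finset V} {g : V → ℕ}

omit [Fintype V] [DecidableEq V] in
theorem mem_of_ne_zero (h : IsLeveling K W g) {v : V} (hv : g v ≠ 0) : v ∈ W := by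
  by_contra hvW
  exact hv (h.eq_zero v hvW)

omit [DecidableEq V] in
theorem levelSupport_subset (h : IsLeveling K W g) : levelSupport g ⊆ W := fun _ hv =>
  h.mem_of_ne_zero (mem_levelSupport.1 hv)

omit [DecidableEq V] in
theorem one_le_height (h : IsLeveling K W g) : 1 ≤ height g := by
  obtain ⟨v, -, hv⟩ := h.exists_eq_one
  exact hv ▸ le_height g v

omit [DecidableEq V] in
theorem exists_eq_height (h : IsLeveling K W g) : ∃ v, g v = height g := by
  obtain ⟨v, -, hv⟩ := h.exists_eq_one
  obtain ⟨w, -, hw⟩ := Finset.exists_mem_eq_sup Finset.univ ⟨v, Finset.mem_univ v⟩ g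
  exact ⟨w, hw.symm⟩

omit [DecidableEq V] in
theorem exists_eq_of_le_height (h : IsLeveling K W g) {n : ℕ} (h1 : 1 ≤ n) (hn : n ≤ height g) :
    ∃ v, g v = n := by
  obtain ⟨w, hw⟩ := h.exists_eq_height
  exact h.exists_eq w n h1 (hw ▸ hn)

omit [DecidableEq V] in
theorem image_levelSupport (h : IsLeveling K W g) :
    (levelSupport g).image g = Finset.Icc 1 (height g) := by
  ext n
  simp only [Finset.mem_image, mem_levelSupport, Finset.mem_Icc]
  constructor
  · rintro ⟨v, hv, rfl⟩
    exact ⟨Nat.one_le_iff_ne_zero.2 hv, le_height g v⟩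
  · rintro ⟨h1, hn⟩
    obtain ⟨v, rfl⟩ := h.exists_eq_of_le_height h1 hn
    exact ⟨v, Nat.one_le_iff_ne_zero.1 h1, rfl⟩

omit [DecidableEq V] in
theorem height_le_card (h : IsLeveling K W g) : height g ≤ (levelSupport g).card := by
  have := Finset.card_image_le (s := levelSupport g) (f := g)
  rwa [h.image_levelSupport, Nat.card_Icc, Nat.add_sub_cancel] at this

end IsLeveling

open Classical in
/-- The finset of levelings. -/
noncomputable def levelings (K W : Finset V) : Finset (V → ℕ) :=
  (Fintype.piFinset fun _ => Finset.range (Fintype.card V + 1)).filter (IsLeveling K W)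

/-- No level up to the height is empty, so all values are at most |V| and the cut-off in `levelings`
loses nothing. -/
theorem mem_levelings {K W : Finset V} {g : V → ℕ} : g ∈ levelings K W ↔ IsLeveling K W g := by
  simp only [levelings, Finset.mem_filter, and_iff_right_iff_imp]
  intro h
  rw [Fintype.mem_piFinset]
  intro v
  rw [Finset.mem_range_succ_iff]
  exact (le_height g v).trans (h.height_le_card.trans (Finset.card_le_univ _))

variable {R : Type*} [CommRing R]

/-- The contribution of a leveling to the `f`-polynomial. -/
def levelWeight (a t : R) (W : Finset V) (g : V → ℕ) : R :=
  a ^ ((levelSupport g).card - height g) * t ^ (W.card - (levelSupport g).card + height g - 1)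

/-- Put the elements of `S` on a new highest level. -/
def addLevel (S : Finset V) (g : V → ℕ) : V → ℕ := fun v => if v ∈ S then height g + 1 else g v

/-- The elements on the highest level. -/
def topLevel (g : V → ℕ) : Finset V := Finset.univ.filter fun v => g v = height g

/-- Move the elements on the highest level to level `0`. -/
def removeLevel (g : V → ℕ) : V → ℕ := fun v => if v ∈ topLevel g then 0 else g v

omit [DecidableEq V] in
@[simp] theorem mem_topLevel {g : V → ℕ} {v : V} : v ∈ topLevel g ↔ g v = height g := by
  simp [topLevel]

theorem height_addLevel {S : Finset V} (hS : S.Nonempty) (g : V → ℕ) :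
    height (addLevel S g) = height g + 1 := by
  refine le_antisymm (Finset.sup_le fun v _ => ?_) ?_
  · unfold addLevel
    split_ifs
    · rfl
    · exact (le_height g v).trans (Nat.le_succ _)
  · obtain ⟨v, hv⟩ := hS
    have := le_height (addLevel S g) v
    rwa [addLevel, if_pos hv] at this

theorem topLevel_addLevel {S : Finset V} (hS : S.Nonempty) (g : V → ℕ) :
    topLevel (addLevel S g) = S := by
  ext v
  rw [mem_topLevel, height_addLevel hS, addLevel]
  have := le_height g v
  split_ifs with hv
  · simp [hv]
  · simp only [hv, iff_false]
    omega

theorem removeLevel_addLevel {S : Finset V} (hS : S.Nonempty) {g : V → ℕ}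
    (hg : ∀ v ∈ S, g v = 0) : removeLevel (addLevel S g) = g := by
  ext v
  rw [removeLevel, topLevel_addLevel hS]
  split_ifs with hv
  · exact (hg v hv).symm
  · rw [addLevel, if_neg hv]

namespace IsLeveling

variable {K W : Finset V} {g : V → ℕ}

theorem height_removeLevel (h : IsLeveling K W g) :
    height (removeLevel g) = height g - 1 := by
  refine le_antisymm (Finset.sup_le fun v _ => ?_) ?_
  · have := le_height g v
    simp only [removeLevel, mem_topLevel]
    split_ifs <;> omega
  · have h1 := h.one_le_height
    obtain h1 | h1 := h1.eq_or_lt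
    · simp [← h1]
    obtain ⟨v, hv⟩ := h.exists_eq_of_le_height (n := height g - 1) (by omega) (by omega)
    have := le_height (removeLevel g) v
    simp only [removeLevel, mem_topLevel] at this
    rwa [if_neg (by omega), hv] at this

theorem addLevel_removeLevel (h : IsLeveling K W g) :
    addLevel (topLevel g) (removeLevel g) = g := by
  ext v
  have h1 := h.one_le_height
  simp only [addLevel, h.height_removeLevel, removeLevel, mem_topLevel]
  split_ifs <;> omega

omit [DecidableEq V] in
theorem topLevel_subset (h : IsLeveling K W g) : topLevel g ⊆ W := fun v hv => by
  have h1 := h.one_le_height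
  have := mem_topLevel.1 hv
  exact h.mem_of_ne_zero (by omega)

omit [DecidableEq V] in
theorem topLevel_nonempty (h : IsLeveling K W g) : (topLevel g).Nonempty := by
  obtain ⟨v, hv⟩ := h.exists_eq_height
  exact ⟨v, mem_topLevel.2 hv⟩

/-- With at least two levels, level 1 survives and still meets K. -/
theorem removeLevel (h : IsLeveling K W g) (h1 : height g ≠ 1) :
    IsLeveling K (W \ topLevel g) (removeLevel g) where
  eq_zero v hv := by
    rw [Finset.mem_sdiff, not_and, not_not] at hv
    rw [_root_.removeLevel]
    split_ifs with hvt
    · rfl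
    · exact h.eq_zero v fun hvW => hvt (hv hvW)
  ne_zero v hvK hv := by
    rw [Finset.mem_sdiff] at hv
    rw [_root_.removeLevel, if_neg hv.2]
    exact h.ne_zero v hvK hv.1
  exists_eq_one := by
    obtain ⟨v, hvK, hv⟩ := h.exists_eq_one
    refine ⟨v, hvK, ?_⟩
    simp only [_root_.removeLevel, mem_topLevel]
    rwa [if_neg (by omega)]
  exists_eq v n hn hnv := by
    have hv := le_height g v
    simp only [_root_.removeLevel, mem_topLevel] at hnv
    split_ifs at hnv with hv'
    · omega
    obtain ⟨w, hw⟩ := h.exists_eq v n hn hnv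
    refine ⟨w, ?_⟩
    simp only [_root_.removeLevel, mem_topLevel]
    rwa [if_neg (by omega)]

omit [Fintype V] in
theorem eq_zero_of_sdiff {S : Finset V} (h : IsLeveling K (W \ S) g) : ∀ v ∈ S, g v = 0 :=
  fun v hv => h.eq_zero v fun hv' => (Finset.mem_sdiff.1 hv').2 hv

theorem addLevel {S : Finset V} (h : IsLeveling K (W \ S) g) (hSW : S ⊆ W) :
    IsLeveling K W (addLevel S g) where
  eq_zero v hv := by
    rw [_root_.addLevel, if_neg fun hvS => hv (hSW hvS)]
    exact h.eq_zero v fun hv' => hv (Finset.mem_sdiff.1 hv').1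
  ne_zero v hvK hvW := by
    rw [_root_.addLevel]
    split_ifs with hvS
    · omega
    · exact h.ne_zero v hvK (Finset.mem_sdiff.2 ⟨hvW, hvS⟩)
  exists_eq_one := by
    obtain ⟨v, hvK, hv⟩ := h.exists_eq_one
    refine ⟨v, hvK, ?_⟩
    rwa [_root_.addLevel, if_neg]
    intro hvS
    have := h.eq_zero_of_sdiff v hvS
    omega
  exists_eq v n hn hnv := by
    by_cases hn' : n ≤ height g
    · obtain ⟨w, hw⟩ := h.exists_eq_of_le_height hn hn'
      refine ⟨w, ?_⟩
      rwa [_root_.addLevel, if_neg]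
      intro hwS
      have := h.eq_zero_of_sdiff w hwS
      omega
    · have := le_height g v
      rw [_root_.addLevel] at hnv
      split_ifs at hnv with hvS
      · refine ⟨v, ?_⟩
        rw [_root_.addLevel, if_pos hvS]
        omega
      · omega

/-- A new level S raises the dimension by |S| - 1, and the codimension by one when W \ S is enlarged
to W. -/
theorem levelWeight_addLevel (a t : R) {S : Finset V} (h : IsLeveling K (W \ S) g) (hSW : S ⊆ W)
    (hS : S.Nonempty) : levelWeight a t W (_root_.addLevel S g) =
      t * (a ^ (S.card - 1) * levelWeight a t (W \ S) g) := by
  have h1 : levelSupport (_root_.addLevel S g) = levelSupport g ∪ S := by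
    ext v
    rw [mem_levelSupport, _root_.addLevel, Finset.mem_union, mem_levelSupport]
    split_ifs with hv <;> simp [hv]
  have h2 : Disjoint (levelSupport g) S := by
    rw [Finset.disjoint_left]
    intro v hv hvS
    exact mem_levelSupport.1 hv (h.eq_zero_of_sdiff v hvS)
  have h3 := Finset.card_sdiff_add_card_eq_card hSW
  have h4 := h.height_le_card
  have h5 := Finset.card_le_card h.levelSupport_subset
  have h6 := h.one_le_height
  have h7 := hS.card_pos
  rw [levelWeight, levelWeight, h1, Finset.card_union_of_disjoint h2, height_addLevel hS,
    show (levelSupport g).card + S.card - (height g + 1) =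
      (S.card - 1) + ((levelSupport g).card - height g) by omega,
    show W.card - ((levelSupport g).card + S.card) + (height g + 1) - 1 =
      ((W \ S).card - (levelSupport g).card + height g - 1) + 1 by omega, pow_add, pow_succ]
  ring

end IsLeveling

/-- A single level consists of W ∩ K and an arbitrary subset D of W \ K; the sum over D is a
binomial expansion. If W misses K there is no leveling at all. -/
theorem sum_levelWeight_height_eq_one (a t : R) (K W : Finset V) :
    ∑ g ∈ levelings K W with height g = 1, levelWeight a t W g =
      if (W ∩ K).card = 0 then 0
      else a ^ ((W ∩ K).card - 1) * (a + t) ^ (W \ K).card := by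
  split_ifs with hK
  · refine Finset.sum_eq_zero fun g hg => ?_
    have h := mem_levelings.1 (Finset.mem_filter.1 hg).1
    obtain ⟨v, hvK, hv⟩ := h.exists_eq_one
    rw [Finset.card_eq_zero] at hK
    exact absurd (hK ▸ Finset.mem_inter.2 ⟨h.mem_of_ne_zero (by omega), hvK⟩ : v ∈ (∅ : Finset V))
      (Finset.notMem_empty v)
  · rw [← Finset.sum_pow_mul_eq_add_pow, Finset.mul_sum]
    have hcard := Finset.card_inter_add_card_sdiff W K
    have hsup : ∀ D : Finset V,
        levelSupport (fun v => if v ∈ W ∩ K ∪ D then 1 else 0) = W ∩ K ∪ D := fun D => by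
      ext v
      rw [mem_levelSupport]
      split_ifs with h <;> simpa using h
    have hheight : ∀ D : Finset V, height (fun v => if v ∈ W ∩ K ∪ D then 1 else 0) = 1 := by
      intro D
      refine le_antisymm (Finset.sup_le fun v _ => by split_ifs <;> simp) ?_
      obtain ⟨v, hv⟩ := Finset.card_pos.1 (Nat.pos_of_ne_zero hK)
      have := le_height (fun v => if v ∈ W ∩ K ∪ D then 1 else 0) v
      rwa [if_pos (Finset.mem_union_left _ hv)] at this
    refine Finset.sum_bij' (fun g _ => levelSupport g \ K)
      (fun D _ v => if v ∈ W ∩ K ∪ D then 1 else 0) ?_ ?_ ?_ ?_ ?_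
    · intro g hg
      have h := mem_levelings.1 (Finset.mem_filter.1 hg).1
      exact Finset.mem_powerset.2 (Finset.sdiff_subset_sdiff h.levelSupport_subset subset_rfl)
    · intro D hD
      refine Finset.mem_filter.2 ⟨mem_levelings.2 ⟨?_, ?_, ?_, ?_⟩, hheight D⟩
      · intro v hv
        refine if_neg fun hv' => hv ?_
        obtain hv' | hv' := Finset.mem_union.1 hv'
        · exact (Finset.mem_inter.1 hv').1
        · exact (Finset.mem_sdiff.1 (Finset.mem_powerset.1 hD hv')).1
      · intro v hvK hvW
        simp [hvK, hvW]
      · obtain ⟨v, hv⟩ := Finset.card_pos.1 (Nat.pos_of_ne_zero hK)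
        exact ⟨v, (Finset.mem_inter.1 hv).2, if_pos (Finset.mem_union_left _ hv)⟩
      · intro v n hn hnv
        refine ⟨v, ?_⟩
        split_ifs at hnv ⊢ <;> omega
    · intro g hg
      obtain ⟨hg, h1⟩ := Finset.mem_filter.1 hg
      have h := mem_levelings.1 hg
      ext v
      have hv := le_height g v
      have h2 : v ∈ W ∩ K ∪ levelSupport g \ K ↔ g v ≠ 0 := by
        rw [Finset.mem_union, Finset.mem_inter, Finset.mem_sdiff, mem_levelSupport]
        refine ⟨?_, fun hv0 => ?_⟩
        · rintro (⟨hvW, hvK⟩ | ⟨h, -⟩)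
          · exact h.ne_zero v hvK hvW
          · exact h
        · by_cases hvK : v ∈ K
          · exact Or.inl ⟨h.mem_of_ne_zero hv0, hvK⟩
          · exact Or.inr ⟨hv0, hvK⟩
      simp only [h2]
      split_ifs <;> omega
    · intro D hD
      have hDK := Finset.mem_powerset.1 hD
      simp only [hsup]
      ext v
      simp only [Finset.mem_sdiff, Finset.mem_union, Finset.mem_inter]
      constructor
      · rintro ⟨⟨-, h⟩ | h, h'⟩
        · exact absurd h h'
        · exact h
      · exact fun h => ⟨Or.inr h, (Finset.mem_sdiff.1 (hDK h)).2⟩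
    · intro g hg
      obtain ⟨hg, h1⟩ := Finset.mem_filter.1 hg
      have h := mem_levelings.1 hg
      have h2 : levelSupport g ∩ K = W ∩ K := by
        ext v
        simp only [Finset.mem_inter, mem_levelSupport]
        exact ⟨fun hv => ⟨h.mem_of_ne_zero hv.1, hv.2⟩, fun hv => ⟨h.ne_zero v hv.2 hv.1, hv.2⟩⟩
      have h3 := Finset.card_inter_add_card_sdiff (levelSupport g) K
      have h5 := Finset.card_le_card h.levelSupport_subset
      rw [h2] at h3
      rw [levelWeight, h1, show (levelSupport g).card - 1 =
        (W ∩ K).card - 1 + (levelSupport g \ K).card by omega, pow_add, mul_assoc,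
        show W.card - (levelSupport g).card + 1 - 1 =
          (W \ K).card - (levelSupport g \ K).card by omega]

/-- Cutting off the highest level S is a bijection onto pairs of a nonempty S ⊆ W and a leveling of
W \ S. -/
theorem sum_levelWeight_height_ne_one (a t : R) (K W : Finset V) :
    ∑ g ∈ levelings K W with ¬ height g = 1, levelWeight a t W g =
      t * ∑ S ∈ W.powerset, if S.card = 0 then 0 else
        a ^ (S.card - 1) * ∑ g ∈ levelings K (W \ S), levelWeight a t (W \ S) g := by
  have h0 : ∀ S : Finset V, (if S.card = 0 then 0 else
        a ^ (S.card - 1) * ∑ g ∈ levelings K (W \ S), levelWeight a t (W \ S) g) =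
      if S.Nonempty then
        ∑ g ∈ levelings K (W \ S), a ^ (S.card - 1) * levelWeight a t (W \ S) g else 0 := by
    intro S
    obtain rfl | hS := S.eq_empty_or_nonempty
    · simp
    · rw [if_neg hS.card_pos.ne', if_pos hS, Finset.mul_sum]
  simp only [h0]
  rw [← Finset.sum_filter, Finset.sum_sigma', Finset.mul_sum]
  refine Finset.sum_bij' (fun g _ => ⟨topLevel g, removeLevel g⟩) (fun p _ => addLevel p.1 p.2)
    ?_ ?_ ?_ ?_ ?_
  · intro g hg
    obtain ⟨hg, h1⟩ := Finset.mem_filter.1 hg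
    have h := mem_levelings.1 hg
    exact Finset.mem_sigma.2 ⟨Finset.mem_filter.2 ⟨Finset.mem_powerset.2 h.topLevel_subset,
      h.topLevel_nonempty⟩, mem_levelings.2 (h.removeLevel h1)⟩
  · rintro ⟨S, g⟩ hp
    obtain ⟨hS, hg⟩ := Finset.mem_sigma.1 hp
    obtain ⟨hSW, hS⟩ := Finset.mem_filter.1 hS
    have h := mem_levelings.1 hg
    have h1 := h.one_le_height
    refine Finset.mem_filter.2 ⟨mem_levelings.2 (h.addLevel (Finset.mem_powerset.1 hSW)), ?_⟩
    rw [height_addLevel hS]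
    dsimp only at h1 ⊢
    omega
  · intro g hg
    exact (mem_levelings.1 (Finset.mem_filter.1 hg).1).addLevel_removeLevel
  · rintro ⟨S, g⟩ hp
    obtain ⟨hS, hg⟩ := Finset.mem_sigma.1 hp
    obtain ⟨hSW, hS⟩ := Finset.mem_filter.1 hS
    have h := mem_levelings.1 hg
    dsimp only at hS ⊢
    rw [topLevel_addLevel hS, removeLevel_addLevel hS h.eq_zero_of_sdiff]
  · intro g hg
    obtain ⟨hg, h1⟩ := Finset.mem_filter.1 hg
    have h := mem_levelings.1 hg
    have := (h.removeLevel h1).levelWeight_addLevel a t h.topLevel_subset h.topLevel_nonempty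
    rwa [h.addLevel_removeLevel] at this

omit [Fintype V] in
theorem sum_powerset_card_inter_card_sdiff (K W : Finset V) (F : ℕ → ℕ → R) :
    ∑ S ∈ W.powerset, F (S ∩ K).card (S \ K).card =
      ∑ i ∈ Finset.range ((W ∩ K).card + 1), ∑ j ∈ Finset.range ((W \ K).card + 1),
        ((W ∩ K).card.choose i * (W \ K).card.choose j : R) * F i j := by
  have h : ∑ S ∈ W.powerset, F (S ∩ K).card (S \ K).card =
      ∑ p ∈ (W ∩ K).powerset ×ˢ (W \ K).powerset, F p.1.card p.2.card := by
    refine Finset.sum_bij' (fun S _ => (S ∩ K, S \ K)) (fun p _ => p.1 ∪ p.2) ?_ ?_ ?_ ?_ ?_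
    · intro S hS
      have hS := Finset.mem_powerset.1 hS
      exact Finset.mem_product.2 ⟨Finset.mem_powerset.2 (Finset.inter_subset_inter_right hS),
        Finset.mem_powerset.2 (Finset.sdiff_subset_sdiff hS subset_rfl)⟩
    · intro p hp
      obtain ⟨h1, h2⟩ := Finset.mem_product.1 hp
      exact Finset.mem_powerset.2 (Finset.union_subset
        ((Finset.mem_powerset.1 h1).trans Finset.inter_subset_left)
        ((Finset.mem_powerset.1 h2).trans Finset.sdiff_subset))
    · intro S _
      ext v
      simp only [Finset.mem_union, Finset.mem_inter, Finset.mem_sdiff]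
      tauto
    · rintro ⟨A, B⟩ hp
      obtain ⟨h1, h2⟩ := Finset.mem_product.1 hp
      have hA := fun v (hv : v ∈ A) => (Finset.mem_inter.1 (Finset.mem_powerset.1 h1 hv)).2
      have hB := fun v (hv : v ∈ B) => (Finset.mem_sdiff.1 (Finset.mem_powerset.1 h2 hv)).2
      refine Prod.ext (Finset.ext fun v => ?_) (Finset.ext fun v => ?_)
      · simp only [Finset.mem_inter, Finset.mem_union]
        have := hA v
        have := hB v
        tauto
      · simp only [Finset.mem_sdiff, Finset.mem_union]
        have := hA v
        have := hB v
        tauto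
    · intro S _
      rfl
  rw [h, Finset.sum_product]
  have h' : ∀ i, ∑ B ∈ (W \ K).powerset, F i B.card =
      ∑ j ∈ Finset.range ((W \ K).card + 1), ((W \ K).card.choose j : R) * F i j := fun i => by
    rw [Finset.sum_powerset_apply_card (fun j => F i j)]
    simp only [nsmul_eq_mul]
  simp only [h']
  rw [Finset.sum_powerset_apply_card (fun i => ∑ j ∈ Finset.range ((W \ K).card + 1),
    ((W \ K).card.choose j : R) * F i j)]
  simp only [nsmul_eq_mul, Finset.mul_sum, mul_assoc]

/-- Splitting off the highest level yields the recursion of `exists_seq_mem_galCone`. That level is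
nonempty, so induction on W identifies both sides. -/
theorem sum_levelWeight_mem_galCone [Algebra ℚ R] (a t : R) (K W : Finset V) :
    ∑ g ∈ levelings K W, levelWeight a t W g ∈
      galCone (a + 2 * t) (t * (a + t)) (W.card - 1) := by
  obtain ⟨f, hf, hrec⟩ := exists_seq_mem_galCone a t
  have key : ∀ W : Finset V,
      ∑ g ∈ levelings K W, levelWeight a t W g = f (W ∩ K).card (W \ K).card := by
    intro W
    induction W using Finset.strongInduction with
    | H W ih =>
      rw [← Finset.sum_filter_add_sum_filter_not _ (fun g => height g = 1),
        sum_levelWeight_height_eq_one, sum_levelWeight_height_ne_one, hrec,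
        ← sum_powerset_card_inter_card_sdiff K W fun i j => (if i + j = 0 then 0
          else a ^ (i + j - 1)) * f ((W ∩ K).card - i) ((W \ K).card - j)]
      congr 2
      refine Finset.sum_congr rfl fun S hS => ?_
      have hS := Finset.mem_powerset.1 hS
      rw [Finset.card_inter_add_card_sdiff]
      split_ifs with h
      · rw [zero_mul]
      · rw [ih _ (Finset.sdiff_ssubset hS (Finset.card_pos.1 (Nat.pos_of_ne_zero h))),
          ← Finset.card_sdiff_of_subset (Finset.inter_subset_inter_right hS),
          ← Finset.card_sdiff_of_subset (Finset.sdiff_subset_sdiff hS subset_rfl)]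
        congr 3 <;>
        · ext v
          simp only [Finset.mem_inter, Finset.mem_sdiff]
          tauto
  have := hf (W ∩ K).card (W \ K).card
  rwa [← key, ← Nat.cast_add, Finset.card_inter_add_card_sdiff] at this

end Levelings

/-! ### Faces and dimension of Minkowski sums of simplices -/

section MinkowskiSum

variable {V : Type} [DecidableEq V]

/-- The elements of `S` at which `c` attains its maximum over `S`. -/
def argmaxOn {α : Type*} [LinearOrder α] (c : V → α) (S : Finset V) : Finset V :=
  S.filter fun i => ∀ j ∈ S, c j ≤ c i

omit [DecidableEq V] in
theorem mem_argmaxOn {α : Type*} [LinearOrder α] {c : V → α} {S : Finset V} {i : V} :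
    i ∈ argmaxOn c S ↔ i ∈ S ∧ ∀ j ∈ S, c j ≤ c i := Finset.mem_filter

omit [DecidableEq V] in
theorem argmaxOn_nonempty {α : Type*} [LinearOrder α] (c : V → α) {S : Finset V}
    (hS : S.Nonempty) : (argmaxOn c S).Nonempty := by
  obtain ⟨i, hi, h⟩ := S.exists_max_image c hS
  exact ⟨i, mem_argmaxOn.2 ⟨hi, h⟩⟩

omit [DecidableEq V] in
theorem argmaxOn_subset {α : Type*} [LinearOrder α] (c : V → α) (S : Finset V) :
    argmaxOn c S ⊆ S := fun _ hi => (mem_argmaxOn.1 hi).1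

theorem single_mem_simplexOn {S : Finset V} {i : V} (hi : i ∈ S) :
    (Pi.single i 1 : V → ℝ) ∈ simplexOn S :=
  subset_convexHull ℝ _ ⟨i, hi, rfl⟩

theorem simplexOn_mono {S T : Finset V} (h : S ⊆ T) : simplexOn S ⊆ simplexOn T :=
  convexHull_mono (Set.image_mono h)

variable [Fintype V]

theorem mem_simplexOn {S : Finset V} {x : V → ℝ} :
    x ∈ simplexOn S ↔ (∀ i, 0 ≤ x i) ∧ (∀ i ∉ S, x i = 0) ∧ ∑ i, x i = 1 := by
  constructor
  · refine fun hx => convexHull_min (s := (fun i : V => (Pi.single i 1 : V → ℝ)) '' (S : Set V))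
      (t := {x : V → ℝ | (∀ i, 0 ≤ x i) ∧ (∀ i ∉ S, x i = 0) ∧ ∑ i, x i = 1}) ?_ ?_ hx
    · rintro _ ⟨j, hj, rfl⟩
      refine ⟨fun i => ?_, fun i hi => ?_, by simp⟩
      · dsimp only
        rw [Pi.single_apply]
        split_ifs <;> norm_num
      · exact Pi.single_eq_of_ne (fun h => hi (by rwa [h])) _
    · rintro x ⟨h1, h2, h3⟩ y ⟨h1', h2', h3'⟩ a b ha hb hab
      refine ⟨fun i => ?_, fun i hi => ?_, ?_⟩
      · exact add_nonneg (mul_nonneg ha (h1 i)) (mul_nonneg hb (h1' i))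
      · simp [h2 i hi, h2' i hi]
      · simp [Finset.sum_add_distrib, ← Finset.mul_sum, h3, h3', hab]
  · rintro ⟨h1, h2, h3⟩
    have hsum : ∑ i ∈ S, x i = 1 := by
      rw [← h3]
      exact Finset.sum_subset (Finset.subset_univ S) fun i _ hi => h2 i hi
    have hx : x = ∑ i ∈ S, x i • (Pi.single i 1 : V → ℝ) := by
      conv_lhs => rw [pi_eq_sum_univ' x]
      exact (Finset.sum_subset (Finset.subset_univ S) fun i _ hi => by rw [h2 i hi, zero_smul]).symm
    rw [hx]
    exact (convex_convexHull ℝ _).sum_mem (fun i _ => h1 i) hsum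
      fun i hi => single_mem_simplexOn hi

/-- The gap is c v - c · x = ∑ (c v - c i) x i with non-negative terms. It vanishes exactly when x
is supported where c is maximal. -/
theorem dotProduct_le_of_mem_simplexOn {c x : V → ℝ} {S : Finset V} {v : V}
    (hv : v ∈ argmaxOn c S) (hx : x ∈ simplexOn S) :
    c ⬝ᵥ x ≤ c v ∧ (c ⬝ᵥ x = c v ↔ x ∈ simplexOn (argmaxOn c S)) := by
  obtain ⟨h1, h2, h3⟩ := mem_simplexOn.1 hx
  have hdiff : c v - c ⬝ᵥ x = ∑ i, (c v - c i) * x i := by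
    simp only [dotProduct, sub_mul, Finset.sum_sub_distrib, ← Finset.mul_sum, h3, mul_one]
  have hnonneg : ∀ i ∈ Finset.univ, 0 ≤ (c v - c i) * x i := by
    intro i _
    by_cases hi : i ∈ S
    · exact mul_nonneg (sub_nonneg.2 ((mem_argmaxOn.1 hv).2 i hi)) (h1 i)
    · rw [h2 i hi, mul_zero]
  refine ⟨sub_nonneg.1 (hdiff ▸ Finset.sum_nonneg hnonneg), ?_⟩
  rw [eq_comm, ← sub_eq_zero, hdiff, Finset.sum_eq_zero_iff_of_nonneg hnonneg]
  constructor
  · refine fun h => mem_simplexOn.2 ⟨h1, fun i hi => ?_, h3⟩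
    by_cases hiS : i ∈ S
    · obtain h | h := mul_eq_zero.1 (h i (Finset.mem_univ i))
      · refine absurd (mem_argmaxOn.2 ⟨hiS, fun j hj => ?_⟩) hi
        rw [← sub_eq_zero.1 h]
        exact (mem_argmaxOn.1 hv).2 j hj
      · exact h
    · exact h2 i hiS
  · intro h i _
    by_cases hi : i ∈ argmaxOn c S
    · rw [le_antisymm ((mem_argmaxOn.1 hi).2 v (mem_argmaxOn.1 hv).1)
        ((mem_argmaxOn.1 hv).2 i (mem_argmaxOn.1 hi).1), sub_self, zero_mul]
    · rw [(mem_simplexOn.1 h).2.1 i hi, mul_zero]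

/-- The face of `P` on which the linear functional with coefficients `c` is maximal. -/
def maxFace (c : V → ℝ) (P : Set (V → ℝ)) : Set (V → ℝ) :=
  {x ∈ P | ∀ y ∈ P, c ⬝ᵥ y ≤ c ⬝ᵥ x}

omit [DecidableEq V] in
theorem isExposed_iff_exists_maxFace {P F : Set (V → ℝ)} (hF : F.Nonempty) :
    IsExposed ℝ P F ↔ ∃ c, F = maxFace c P := by
  classical
  constructor
  · intro h
    obtain ⟨l, hl⟩ := h hF
    have key : ∀ x, (fun i => l (Pi.single i 1)) ⬝ᵥ x = l x := by
      intro x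
      conv_rhs => rw [pi_eq_sum_univ' x, map_sum]
      simp only [map_smul, smul_eq_mul, dotProduct, mul_comm]
    refine ⟨fun i => l (Pi.single i 1), ?_⟩
    simp only [hl, maxFace, key]
  · rintro ⟨c, rfl⟩ -
    refine ⟨∑ i, c i • ContinuousLinearMap.proj i, ?_⟩
    simp [maxFace, dotProduct]

variable {B : Finset (Finset V)}

/-- Take for M the sum of the maxima over the summands: termwise inequalities add up to an equality
only if each is one. -/
theorem exists_value_mem_sum_simplexOn_argmaxOn_iff (hB : ∀ S ∈ B, S.Nonempty) (c : V → ℝ) :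
    ∃ M : ℝ, ∀ x : Finset V → V → ℝ, (∀ S ∈ B, x S ∈ simplexOn S) →
      c ⬝ᵥ ∑ S ∈ B, x S ≤ M ∧
      (c ⬝ᵥ ∑ S ∈ B, x S = M ↔ ∀ S ∈ B, x S ∈ simplexOn (argmaxOn c S)) := by
  have h : ∀ S : Finset V, ∃ m : ℝ, S ∈ B → ∀ x ∈ simplexOn S,
      c ⬝ᵥ x ≤ m ∧ (c ⬝ᵥ x = m ↔ x ∈ simplexOn (argmaxOn c S)) := by
    intro S
    by_cases hS : S ∈ B
    · obtain ⟨v, hv⟩ := argmaxOn_nonempty c (hB S hS)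
      exact ⟨c v, fun _ x hx => dotProduct_le_of_mem_simplexOn hv hx⟩
    · exact ⟨0, fun h => absurd h hS⟩
  choose m hm using h
  refine ⟨∑ S ∈ B, m S, fun x hx => ?_⟩
  rw [dotProduct_sum]
  refine ⟨Finset.sum_le_sum fun S hS => (hm S hS (x S) (hx S hS)).1, ?_⟩
  rw [Finset.sum_eq_sum_iff_of_le fun S hS => (hm S hS (x S) (hx S hS)).1]
  exact forall₂_congr fun S hS => (hm S hS (x S) (hx S hS)).2

theorem maxFace_sum_simplexOn (hB : ∀ S ∈ B, S.Nonempty) (c : V → ℝ) :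
    maxFace c (∑ S ∈ B, simplexOn S) = ∑ S ∈ B, simplexOn (argmaxOn c S) := by
  obtain ⟨M, hM⟩ := exists_value_mem_sum_simplexOn_argmaxOn_iff hB c
  have hle : ∀ S, simplexOn (argmaxOn c S) ⊆ simplexOn S := fun S =>
    simplexOn_mono (argmaxOn_subset _ _)
  ext x
  rw [Set.mem_finsetSum]
  constructor
  · rintro ⟨hx, hmax⟩
    obtain ⟨y, hy, rfl⟩ := (Set.mem_finsetSum _ _ _).1 hx
    obtain ⟨hyM, hiff⟩ := hM y fun S hS => hy hS
    refine ⟨y, fun {S} hS => hiff.1 (le_antisymm hyM ?_) S hS, rfl⟩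
    have hne : ∀ S : Finset V, ∃ z : V → ℝ, S ∈ B → z ∈ simplexOn (argmaxOn c S) := by
      intro S
      by_cases hS : S ∈ B
      · obtain ⟨v, hv⟩ := argmaxOn_nonempty c (hB S hS)
        exact ⟨_, fun _ => single_mem_simplexOn hv⟩
      · exact ⟨0, fun h => absurd h hS⟩
    choose z hz using hne
    rw [← (hM z fun S hS => hle S (hz S hS)).2.2 hz]
    exact hmax _ ((Set.mem_finsetSum _ _ _).2 ⟨z, fun {S} hS => hle S (hz S hS), rfl⟩)
  · rintro ⟨y, hy, rfl⟩
    refine ⟨(Set.mem_finsetSum _ _ _).2 ⟨y, fun {S} hS => hle S (hy hS), rfl⟩, fun w hw => ?_⟩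
    obtain ⟨w, hw', rfl⟩ := (Set.mem_finsetSum _ _ _).1 hw
    rw [(hM y fun S hS => hle S (hy hS)).2.2 fun S hS => hy hS]
    exact (hM w fun S hS => hw' hS).1

/-- The sum of the barycentres of the c-maximal simplices lies in the c'-face, so each barycentre is
c'-maximal in its own summand. As a barycentre has full support, its whole simplex is c'-maximal. -/
theorem argmaxOn_subset_of_sum_simplexOn_subset (hB : ∀ S ∈ B, S.Nonempty) {c c' : V → ℝ}
    (h : ∑ S ∈ B, simplexOn (argmaxOn c S) ⊆ ∑ S ∈ B, simplexOn (argmaxOn c' S))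
    {S : Finset V} (hS : S ∈ B) : argmaxOn c S ⊆ argmaxOn c' S := by
  obtain ⟨M, hM⟩ := exists_value_mem_sum_simplexOn_argmaxOn_iff hB c'
  have hle : ∀ (c : V → ℝ) S, simplexOn (argmaxOn c S) ⊆ simplexOn S := fun c S =>
    simplexOn_mono (argmaxOn_subset _ _)
  have hx : ∀ S ∈ B, (fun i => if i ∈ argmaxOn c S then ((argmaxOn c S).card : ℝ)⁻¹ else 0) ∈
      simplexOn (argmaxOn c S) := by
    intro S hS
    have hpos : (0 : ℝ) < (argmaxOn c S).card := by
      exact_mod_cast (argmaxOn_nonempty c (hB S hS)).card_pos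
    refine mem_simplexOn.2 ⟨fun i => ?_, fun i hi => if_neg hi, ?_⟩
    · positivity
    · rw [Finset.sum_ite_mem, Finset.univ_inter, Finset.sum_const, nsmul_eq_mul,
        mul_inv_cancel₀ hpos.ne']
  obtain ⟨y, hy, hyx⟩ := (Set.mem_finsetSum _ _ _).1
    (h ((Set.mem_finsetSum _ _ _).2 ⟨_, fun {S} hS => hx S hS, rfl⟩))
  have h1 := (hM y fun S hS => hle c' S (hy hS)).2.2 fun S hS => hy hS
  rw [hyx] at h1
  have h2 := (hM _ fun S hS => hle c S (hx S hS)).2.1 h1 S hS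
  intro i hi
  by_contra hi'
  have h3 := (mem_simplexOn.1 h2).2.1 i hi'
  have hpos : (0 : ℝ) < (argmaxOn c S).card := by exact_mod_cast Finset.card_pos.2 ⟨i, hi⟩
  rw [if_pos hi] at h3
  exact (inv_pos.2 hpos).ne' h3

/-- The dimension of a Minkowski sum of simplices whose connected components are the fibres
of `q`. -/
theorem convDim_sum_simplexOn {Q : Type*} [Fintype Q] [DecidableEq Q] {T : Finset V → Finset V}
    (hT : ∀ S ∈ B, (T S).Nonempty) {q : V → Q} (hq : Function.Surjective q)
    (h1 : ∀ S ∈ B, ∀ i ∈ T S, ∀ j ∈ T S, q i = q j)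
    (h2 : ∀ i j, q i = q j → ∃ S ∈ B, i ∈ T S ∧ j ∈ T S) :
    convDim (∑ S ∈ B, simplexOn (T S)) = Fintype.card V - Fintype.card Q := by
  obtain ⟨rep, hrep⟩ := hq.hasRightInverse
  -- L adds up the coordinates over each fibre of `q`, and N is a section of L. The direction space
  -- will be the kernel of L.
  set L : (V → ℝ) →ₗ[ℝ] (Q → ℝ) :=
    Fintype.linearCombination ℝ fun i : V => (Pi.single (q i) 1 : Q → ℝ) with hL
  set N : (Q → ℝ) →ₗ[ℝ] (V → ℝ) :=
    Fintype.linearCombination ℝ fun p : Q => (Pi.single (rep p) 1 : V → ℝ) with hN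
  have hL1 : ∀ i, L (Pi.single i 1) = Pi.single (q i) 1 := fun i => by
    rw [hL, Fintype.linearCombination_apply_single, one_smul]
  have hN1 : ∀ p, N (Pi.single p 1) = Pi.single (rep p) 1 := fun p => by
    rw [hN, Fintype.linearCombination_apply_single, one_smul]
  have hLN : ∀ y, L (N y) = y := by
    intro y
    conv_lhs => rw [pi_eq_sum_univ' y]
    conv_rhs => rw [pi_eq_sum_univ' y]
    simp only [map_sum, map_smul, hL1, hN1, hrep _]
  have hspan : vectorSpan ℝ (∑ S ∈ B, simplexOn (T S)) = LinearMap.ker L := by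
    have hsub : ∀ S ∈ B, ∀ i ∈ T S, ∀ x ∈ simplexOn (T S), L x = Pi.single (q i) 1 := by
      intro S hS i hi x hx
      refine convexHull_min (t := L ⁻¹' {Pi.single (q i) 1}) ?_
        ((convex_singleton _).linear_preimage L) hx
      rintro _ ⟨j, hj, rfl⟩
      exact (hL1 j).trans (by rw [h1 S hS j hj i hi])
    apply le_antisymm
    · rw [vectorSpan_def, Submodule.span_le]
      rintro _ ⟨x, hx, y, hy, rfl⟩
      obtain ⟨x, hx', rfl⟩ := (Set.mem_finsetSum _ _ _).1 hx
      obtain ⟨y, hy', rfl⟩ := (Set.mem_finsetSum _ _ _).1 hy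
      dsimp only
      rw [SetLike.mem_coe, LinearMap.mem_ker, vsub_eq_sub, map_sub, sub_eq_zero, map_sum, map_sum]
      refine Finset.sum_congr rfl fun S hS => ?_
      obtain ⟨i, hi⟩ := hT S hS
      rw [hsub S hS i hi _ (hx' hS), hsub S hS i hi _ (hy' hS)]
    · intro x hx
      have hxN : N (L x) = 0 := by rw [LinearMap.mem_ker.1 hx, map_zero]
      have hx' : x = ∑ i, x i • ((Pi.single i 1 : V → ℝ) - Pi.single (rep (q i)) 1) := by
        rw [pi_eq_sum_univ' x] at hxN
        simp only [map_sum, map_smul, hL1, hN1] at hxN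
        simp only [smul_sub, Finset.sum_sub_distrib]
        rw [hxN, sub_zero]
        exact pi_eq_sum_univ' x
      rw [hx']
      refine Submodule.sum_mem _ fun i _ => Submodule.smul_mem _ _ ?_
      obtain ⟨S₀, hS₀, hi, hj⟩ := h2 i (rep (q i)) (hrep (q i)).symm
      have hne : ∀ S : Finset V, ∃ v, S ∈ B → v ∈ T S := fun S => by
        by_cases hS : S ∈ B
        · obtain ⟨v, hv⟩ := hT S hS
          exact ⟨v, fun _ => hv⟩
        · exact ⟨i, fun h => absurd h hS⟩
      choose v hv using hne
      -- Changing the chosen vertex in the summand S₀ alone produces the difference of two basis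
      -- vectors as a direction.
      have hmem : ∀ w ∈ T S₀, ∑ S ∈ B, (Pi.single (Function.update v S₀ w S) 1 : V → ℝ) ∈
          ∑ S ∈ B, simplexOn (T S) := by
        refine fun w hw => (Set.mem_finsetSum _ _ _).2
          ⟨_, fun {S} hS => single_mem_simplexOn ?_, rfl⟩
        by_cases h : S = S₀
        · subst h
          rwa [Function.update_self]
        · rw [Function.update_of_ne h]
          exact hv S hS
      have := vsub_mem_vectorSpan ℝ (hmem i hi) (hmem _ hj)
      have hsum : ∑ S ∈ B, ((Pi.single (Function.update v S₀ i S) 1 : V → ℝ) -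
          Pi.single (Function.update v S₀ (rep (q i)) S) 1) =
          Pi.single i 1 - Pi.single (rep (q i)) 1 := by
        rw [Finset.sum_eq_single S₀, Function.update_self, Function.update_self]
        · intro S _ hS
          rw [Function.update_of_ne hS, Function.update_of_ne hS, sub_self]
        · exact fun h => absurd hS₀ h
      rwa [vsub_eq_sub, ← Finset.sum_sub_distrib, hsum] at this
  have hrange : LinearMap.range L = ⊤ := LinearMap.range_eq_top.2 fun y => ⟨N y, hLN y⟩
  have hrank := L.finrank_range_add_finrank_ker
  rw [hrange, finrank_top, Module.finrank_fintype_fun_eq_card,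
    Module.finrank_fintype_fun_eq_card] at hrank
  rw [convDim, hspan]
  omega

end MinkowskiSum

/-! ### Faces of the nestohedron as levelings -/

section Faces

variable {V : Type} [Fintype V] [DecidableEq V]

/-- The number of values of `c` between `m` and `c v`. -/
noncomputable def rankAbove (c : V → ℝ) (m : ℝ) (v : V) : ℕ :=
  ((Finset.univ.image c).filter fun a => m ≤ a ∧ a ≤ c v).card

omit [DecidableEq V] in
theorem rankAbove_mono (c : V → ℝ) (m : ℝ) {v w : V} (h : c v ≤ c w) :
    rankAbove c m v ≤ rankAbove c m w := by
  refine Finset.card_le_card fun a ha => ?_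
  obtain ⟨h1, h2, h3⟩ := Finset.mem_filter.1 ha
  exact Finset.mem_filter.2 ⟨h1, h2, h3.trans h⟩

omit [DecidableEq V] in
theorem rankAbove_lt (c : V → ℝ) {m : ℝ} {v w : V} (hm : m ≤ c w) (h : c v < c w) :
    rankAbove c m v < rankAbove c m w := by
  refine Finset.card_lt_card (Finset.ssubset_iff_of_subset (fun a ha => ?_) |>.2 ⟨c w, ?_, ?_⟩)
  · obtain ⟨h1, h2, h3⟩ := Finset.mem_filter.1 ha
    exact Finset.mem_filter.2 ⟨h1, h2, h3.trans h.le⟩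
  · exact Finset.mem_filter.2 ⟨Finset.mem_image_of_mem c (Finset.mem_univ w), hm, le_rfl⟩
  · exact fun hw => h.not_ge (Finset.mem_filter.1 hw).2.2

omit [DecidableEq V] in
theorem rankAbove_eq_zero_iff (c : V → ℝ) (m : ℝ) (v : V) : rankAbove c m v = 0 ↔ c v < m := by
  rw [rankAbove, Finset.card_eq_zero, Finset.filter_eq_empty_iff]
  constructor
  · intro h
    by_contra hv
    exact h (Finset.mem_image_of_mem c (Finset.mem_univ v)) ⟨not_lt.1 hv, le_rfl⟩
  · rintro h a - ⟨h1, h2⟩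
    exact absurd (h1.trans h2) h.not_ge

omit [DecidableEq V] in
theorem le_of_rankAbove_le (c : V → ℝ) {m : ℝ} {v w : V} (hv : m ≤ c v)
    (h : rankAbove c m w ≤ rankAbove c m v) : c w ≤ c v := by
  by_contra hlt
  have hlt := not_le.1 hlt
  exact absurd (rankAbove_lt c (hv.trans hlt.le) hlt) h.not_gt

-- Among elements with values in [m, c v], distinct values have distinct ranks, and there are
-- `rankAbove c m v` such values. Their ranks therefore fill the whole interval from 1 to `rankAbove
-- c m v`.
omit [DecidableEq V] in
theorem exists_rankAbove_eq (c : V → ℝ) (m : ℝ) (v : V) (n : ℕ) (h1 : 1 ≤ n)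
    (hn : n ≤ rankAbove c m v) : ∃ w, rankAbove c m w = n := by
  set U : Finset V := Finset.univ.filter fun w => m ≤ c w ∧ c w ≤ c v with hU
  have hcard : (U.image (rankAbove c m)).card = rankAbove c m v := by
    have h : U.image c = (Finset.univ.image c).filter fun a => m ≤ a ∧ a ≤ c v := by
      rw [hU, Finset.filter_image]
    have hcomp : rankAbove c m =
        (fun b => ((Finset.univ.image c).filter fun a => m ≤ a ∧ a ≤ b).card) ∘ c := rfl
    have hcard : rankAbove c m v = (U.image c).card := by rw [rankAbove, ← h]
    rw [hcard, hcomp, ← Finset.image_image]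
    refine Finset.card_image_of_injOn fun a ha b hb hab => ?_
    obtain ⟨w, hw, rfl⟩ := Finset.mem_image.1 ha
    obtain ⟨w', hw', rfl⟩ := Finset.mem_image.1 hb
    have hab : rankAbove c m w = rankAbove c m w' := hab
    exact le_antisymm (le_of_rankAbove_le c (Finset.mem_filter.1 hw').2.1 hab.le)
      (le_of_rankAbove_le c (Finset.mem_filter.1 hw).2.1 hab.ge)
  have heq : U.image (rankAbove c m) = Finset.Icc 1 (rankAbove c m v) := by
    refine Finset.eq_of_subset_of_card_le (fun a ha => ?_) (by simp [hcard])
    obtain ⟨w, hw, rfl⟩ := Finset.mem_image.1 ha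
    obtain ⟨-, hmw, hwv⟩ := Finset.mem_filter.1 hw
    refine Finset.mem_Icc.2 ⟨Nat.one_le_iff_ne_zero.2 fun h => ?_, rankAbove_mono c m hwv⟩
    exact absurd ((rankAbove_eq_zero_iff c m w).1 h) hmw.not_gt
  obtain ⟨w, -, hw⟩ := Finset.mem_image.1 (heq.symm ▸ Finset.mem_Icc.2 ⟨h1, hn⟩)
  exact ⟨w, hw⟩

/-- Every direction can be replaced by a leveling. -/
theorem exists_leveling_argmaxOn_eq {K : Finset V} (hK : K.Nonempty) (c : V → ℝ) :
    ∃ g, IsLeveling K Finset.univ g ∧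
      ∀ S : Finset V, ((S ∩ K).Nonempty ∨ ∃ v, S = {v}) → argmaxOn c S = argmaxOn g S := by
  obtain ⟨k₀, hk₀, hmin⟩ := K.exists_min_image c hK
  -- The threshold is the minimum of c over K: a set meeting K has its maximum at or above it, so
  -- everything below may be merged into level 0. On singletons every direction agrees.
  refine ⟨rankAbove c (c k₀), ⟨fun v hv => absurd (Finset.mem_univ v) hv, fun v hv _ h => ?_,
    ⟨k₀, hk₀, ?_⟩, exists_rankAbove_eq c (c k₀)⟩, ?_⟩
  · exact absurd ((rankAbove_eq_zero_iff _ _ _).1 h) (hmin v hv).not_gt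
  · rw [rankAbove, Finset.card_eq_one]
    refine ⟨c k₀, ?_⟩
    ext a
    rw [Finset.mem_filter, Finset.mem_singleton]
    constructor
    · exact fun h => le_antisymm h.2.2 h.2.1
    · rintro rfl
      exact ⟨Finset.mem_image_of_mem c (Finset.mem_univ k₀), le_rfl, le_rfl⟩
  · rintro S (⟨i, hi⟩ | ⟨v, rfl⟩)
    · obtain ⟨hiS, hiK⟩ := Finset.mem_inter.1 hi
      ext v
      rw [mem_argmaxOn, mem_argmaxOn]
      refine and_congr_right fun _ => ⟨fun h w hw => rankAbove_mono c _ (h w hw), fun h w hw => ?_⟩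
      refine le_of_rankAbove_le c (not_lt.1 fun hlt => ?_) (h w hw)
      have := h i hiS
      rw [(rankAbove_eq_zero_iff _ _ _).2 hlt, Nat.le_zero, rankAbove_eq_zero_iff] at this
      exact absurd this (hmin i hiK).not_gt
    · ext w
      simp only [mem_argmaxOn, Finset.mem_singleton]
      refine and_congr_right ?_
      rintro rfl
      simp

/-- Testing on the triples {k₀, v, w} with k₀ ∈ K on level 1 of g shows that g and g' order the
nodes above k₀ alike. Since g skips no level, induction on g v bounds it by g' v. -/
theorem IsLeveling.le_of_argmaxOn_eq {K : Finset V} {g g' : V → ℕ}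
    (hg : IsLeveling K Finset.univ g) (hg' : IsLeveling K Finset.univ g')
    (h : ∀ S : Finset V, (S ∩ K).Nonempty → argmaxOn g S = argmaxOn g' S) (v : V) :
    g v ≤ g' v := by
  obtain ⟨k₀, hk₀, hk₀1⟩ := hg.exists_eq_one
  have hcmp : ∀ v w, g k₀ ≤ g v → g w ≤ g v → g' w ≤ g' v ∧ g' k₀ ≤ g' v := by
    intro v w h0 hw
    have hv : v ∈ argmaxOn g {k₀, v, w} := by
      refine mem_argmaxOn.2 ⟨by simp, fun j hj => ?_⟩
      simp only [Finset.mem_insert, Finset.mem_singleton] at hj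
      rcases hj with rfl | rfl | rfl
      exacts [h0, le_rfl, hw]
    rw [h _ ⟨k₀, by simp [hk₀]⟩, mem_argmaxOn] at hv
    exact ⟨hv.2 w (by simp), hv.2 k₀ (by simp)⟩
  have hcmp' : ∀ v w, g' k₀ ≤ g' v → g' w ≤ g' v → g w ≤ g v := by
    intro v w h0 hw
    have hv : v ∈ argmaxOn g' {k₀, v, w} := by
      refine mem_argmaxOn.2 ⟨by simp, fun j hj => ?_⟩
      simp only [Finset.mem_insert, Finset.mem_singleton] at hj
      rcases hj with rfl | rfl | rfl
      exacts [h0, le_rfl, hw]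
    rw [← h _ ⟨k₀, by simp [hk₀]⟩, mem_argmaxOn] at hv
    exact hv.2 w (by simp)
  have hk₀' : 1 ≤ g' k₀ := Nat.one_le_iff_ne_zero.2 (hg'.ne_zero k₀ hk₀ (Finset.mem_univ _))
  suffices key : ∀ n v, g v = n → n ≤ g' v from key _ v rfl
  intro n
  induction n with
  | zero => exact fun v _ => Nat.zero_le _
  | succ n ih =>
    intro v hv
    have hvk : g' k₀ ≤ g' v := (hcmp v v (by omega) le_rfl).2
    obtain rfl | hn := n.eq_zero_or_pos
    · omega
    · obtain ⟨w, hw⟩ := hg.exists_eq v n hn (by omega)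
      have := ih w hw
      by_contra hlt
      have := hcmp' w v (hcmp w w (by omega) le_rfl).2 (by omega)
      omega

variable {B : Finset (Finset V)} {K : Finset V}

omit [Fintype V] [DecidableEq V] in
theorem argmaxOn_natCast (g : V → ℕ) (S : Finset V) :
    argmaxOn (fun v => (g v : ℝ)) S = argmaxOn g S := by
  ext v
  simp only [mem_argmaxOn, Nat.cast_le]

theorem IsLeveling.eq_of_sum_simplexOn_eq (hB : ∀ S, S ∈ B ↔ (S ∩ K).Nonempty ∨ ∃ v, S = {v})
    {g g' : V → ℕ} (hg : IsLeveling K Finset.univ g) (hg' : IsLeveling K Finset.univ g')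
    (h : ∑ S ∈ B, simplexOn (argmaxOn g S) = ∑ S ∈ B, simplexOn (argmaxOn g' S)) : g = g' := by
  have hne : ∀ S ∈ B, S.Nonempty := fun S hS => by
    obtain h | ⟨v, rfl⟩ := (hB S).1 hS
    · exact h.mono Finset.inter_subset_left
    · exact Finset.singleton_nonempty v
  have key : ∀ S ∈ B, argmaxOn g S = argmaxOn g' S := by
    simp only [← argmaxOn_natCast] at h ⊢
    exact fun S hS => Finset.Subset.antisymm
      (argmaxOn_subset_of_sum_simplexOn_subset hne h.subset hS)
      (argmaxOn_subset_of_sum_simplexOn_subset hne h.symm.subset hS)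
  have key' : ∀ S : Finset V, (S ∩ K).Nonempty → argmaxOn g S = argmaxOn g' S :=
    fun S hS => key S ((hB S).2 (Or.inl hS))
  ext v
  exact le_antisymm (hg.le_of_argmaxOn_eq hg' key' v)
    (hg'.le_of_argmaxOn_eq hg (fun S hS => (key' S hS).symm) v)

/-- The classes of nodes linked by the maximal simplices are the positive levels and the single
nodes of level 0, |V| - |levelSupport| + height in all. -/
theorem IsLeveling.convDim_eq (hB : ∀ S, S ∈ B ↔ (S ∩ K).Nonempty ∨ ∃ v, S = {v})
    {g : V → ℕ} (hg : IsLeveling K Finset.univ g) :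
    convDim (∑ S ∈ B, simplexOn (argmaxOn g S)) = (levelSupport g).card - height g := by
  set q : V → V ⊕ ℕ := fun v => if g v = 0 then Sum.inl v else Sum.inr (g v) with hq
  have hq0 : ∀ {v}, g v = 0 → q v = Sum.inl v := fun h => if_pos h
  have hq1 : ∀ {v}, g v ≠ 0 → q v = Sum.inr (g v) := fun h => if_neg h
  have hcard : (Finset.univ.image q).card =
      Fintype.card V - (levelSupport g).card + height g := by
    have h1 : Finset.univ.image q =
        (levelSupport g)ᶜ.disjSum ((levelSupport g).image g) := by
      ext (v | n)
      · simp only [Finset.mem_image, Finset.mem_univ, true_and, Finset.inl_mem_disjSum,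
          Finset.mem_compl, mem_levelSupport, not_not]
        constructor
        · rintro ⟨w, hw⟩
          by_cases h : g w = 0
          · rw [hq0 h] at hw
            rwa [← Sum.inl_injective hw]
          · rw [hq1 h] at hw
            cases hw
        · exact fun h => ⟨v, hq0 h⟩
      · simp only [Finset.mem_image, Finset.mem_univ, true_and, Finset.inr_mem_disjSum,
          mem_levelSupport]
        constructor
        · rintro ⟨w, hw⟩
          by_cases h : g w = 0
          · rw [hq0 h] at hw
            cases hw
          · rw [hq1 h] at hw
            exact ⟨w, h, Sum.inr_injective hw⟩
        · rintro ⟨w, h, rfl⟩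
          exact ⟨w, hq1 h⟩
    rw [h1, Finset.card_disjSum, Finset.card_compl, hg.image_levelSupport, Nat.card_Icc,
      Nat.add_sub_cancel]
  obtain ⟨k₀, hk₀, hk₀1⟩ := hg.exists_eq_one
  have hle := hg.height_le_card
  have hle' := Finset.card_le_univ (levelSupport g)
  rw [convDim_sum_simplexOn (Q := Finset.univ.image q)
    (q := fun v => ⟨q v, Finset.mem_image_of_mem q (Finset.mem_univ v)⟩), Fintype.card_coe, hcard]
  · omega
  · intro S hS
    refine argmaxOn_nonempty g ?_
    obtain h | ⟨v, rfl⟩ := (hB S).1 hS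
    · exact h.mono Finset.inter_subset_left
    · exact Finset.singleton_nonempty v
  · rintro ⟨p, hp⟩
    obtain ⟨v, -, rfl⟩ := Finset.mem_image.1 hp
    exact ⟨v, rfl⟩
  · intro S hS i hi j hj
    rw [mem_argmaxOn] at hi hj
    rw [Subtype.mk.injEq]
    obtain ⟨k, hk⟩ | ⟨v, rfl⟩ := (hB S).1 hS
    · obtain ⟨hkS, hkK⟩ := Finset.mem_inter.1 hk
      have hk0 := hg.ne_zero k hkK (Finset.mem_univ k)
      have h1 := hi.2 k hkS
      have h2 := hi.2 j hj.1
      have h3 := hj.2 i hi.1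
      rw [hq1 (by omega), hq1 (by omega), le_antisymm h2 h3]
    · rw [Finset.mem_singleton.1 hi.1, Finset.mem_singleton.1 hj.1]
  · intro i j hij
    rw [Subtype.mk.injEq] at hij
    by_cases hi : g i = 0
    · rw [hq0 hi] at hij
      by_cases hj : g j = 0
      · rw [hq0 hj] at hij
        obtain rfl := Sum.inl_injective hij
        exact ⟨{i}, (hB _).2 (Or.inr ⟨i, rfl⟩), by simp [mem_argmaxOn]⟩
      · rw [hq1 hj] at hij
        cases hij
    · rw [hq1 hi] at hij
      by_cases hj : g j = 0
      · rw [hq0 hj] at hij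
        cases hij
      · rw [hq1 hj] at hij
        have hij := Sum.inr_injective hij
        -- As k₀ is on level 1, it cannot exceed i and j, and it puts the triple into B.
        refine ⟨{k₀, i, j}, (hB _).2 (Or.inl ⟨k₀, by simp [hk₀]⟩), ?_⟩
        simp only [mem_argmaxOn, Finset.mem_insert, Finset.mem_singleton, forall_eq_or_imp,
          forall_eq, or_true, true_or, true_and]
        omega

/-- The constant direction 1 is a leveling whose face is the whole polytope. -/
theorem convDim_sum_simplexOn_of_mem_iff (hK : K.Nonempty)
    (hB : ∀ S, S ∈ B ↔ (S ∩ K).Nonempty ∨ ∃ v, S = {v}) :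
    convDim (∑ S ∈ B, simplexOn S) = Fintype.card V - 1 := by
  have hg : IsLeveling K Finset.univ (fun _ => 1) := by
    obtain ⟨k, hk⟩ := hK
    exact ⟨fun v hv => absurd (Finset.mem_univ v) hv, fun _ _ _ => one_ne_zero, ⟨k, hk, rfl⟩,
      fun v n h1 h2 => ⟨v, le_antisymm h1 h2⟩⟩
  have h := hg.convDim_eq hB
  have hle := hg.one_le_height
  have hle' : height (fun _ : V => 1) ≤ 1 := Finset.sup_le fun _ _ => le_rfl
  have harg : ∀ S : Finset V, argmaxOn (fun _ : V => 1) S = S := fun S => by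
    ext v
    simp [mem_argmaxOn]
  have hsupp : levelSupport (fun _ : V => 1) = Finset.univ := by
    ext v
    simp
  simp only [harg] at h
  rw [h, hsupp, le_antisymm hle' hle, Finset.card_univ]

/-- The faces of the nestohedron correspond to levelings. -/
theorem faceCount_eq_card (hK : K.Nonempty)
    (hB : ∀ S, S ∈ B ↔ (S ∩ K).Nonempty ∨ ∃ v, S = {v}) (i : ℕ) :
    faceCount (∑ S ∈ B, simplexOn S) i =
      ((levelings K Finset.univ).filter fun g => (levelSupport g).card - height g = i).card := by
  have hne : ∀ S ∈ B, S.Nonempty := fun S hS => by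
    obtain h | ⟨v, rfl⟩ := (hB S).1 hS
    · exact h.mono Finset.inter_subset_left
    · exact Finset.singleton_nonempty v
  have hface : ∀ g : V → ℕ, ∑ S ∈ B, simplexOn (argmaxOn g S) =
      maxFace (fun v => (g v : ℝ)) (∑ S ∈ B, simplexOn S) := fun g => by
    simp only [maxFace_sum_simplexOn hne, argmaxOn_natCast]
  have hset : {F : Set (V → ℝ) | F.Nonempty ∧ IsExposed ℝ (∑ S ∈ B, simplexOn S) F ∧
      convDim F = i} = (fun g : V → ℕ => ∑ S ∈ B, simplexOn (argmaxOn g S)) ''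
      ((levelings K Finset.univ).filter fun g => (levelSupport g).card - height g = i : Finset _) := by
    ext F
    simp only [Set.mem_ofPred_eq, Set.mem_image, Finset.mem_coe, Finset.mem_filter, mem_levelings]
    constructor
    · rintro ⟨hF, hexp, rfl⟩
      obtain ⟨c, rfl⟩ := (isExposed_iff_exists_maxFace hF).1 hexp
      obtain ⟨g, hg, hgc⟩ := exists_leveling_argmaxOn_eq hK c
      have heq : ∑ S ∈ B, simplexOn (argmaxOn g S) = maxFace c (∑ S ∈ B, simplexOn S) := by
        rw [maxFace_sum_simplexOn hne]
        exact Finset.sum_congr rfl fun S hS => by rw [hgc S ((hB S).1 hS)]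
      exact ⟨g, ⟨hg, by rw [← heq, hg.convDim_eq hB]⟩, heq⟩
    · rintro ⟨g, ⟨hg, rfl⟩, rfl⟩
      have hF : (∑ S ∈ B, simplexOn (argmaxOn g S)).Nonempty := by
        have hex : ∀ S : Finset V, ∃ z : V → ℝ, S ∈ B → z ∈ simplexOn (argmaxOn g S) := by
          intro S
          by_cases hS : S ∈ B
          · obtain ⟨v, hv⟩ := argmaxOn_nonempty g (hne S hS)
            exact ⟨_, fun _ => single_mem_simplexOn hv⟩
          · exact ⟨0, fun h => absurd h hS⟩
        choose z hz using hex
        exact ⟨_, (Set.mem_finsetSum _ _ _).2 ⟨z, fun {S} hS => hz S hS, rfl⟩⟩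
      exact ⟨hF, (isExposed_iff_exists_maxFace hF).2 ⟨_, hface g⟩, hg.convDim_eq hB⟩
  rw [faceCount, hset, Set.InjOn.ncard_image, Set.ncard_coe_finset]
  intro g hg g' hg' h
  simp only [Finset.mem_coe, Finset.mem_filter, mem_levelings] at hg hg'
  exact hg.1.eq_of_sum_simplexOn_eq hB hg'.1 h

theorem hPoly_sum_simplexOn (hK : K.Nonempty)
    (hB : ∀ S, S ∈ B ↔ (S ∩ K).Nonempty ∨ ∃ v, S = {v}) :
    hPoly (∑ S ∈ B, simplexOn S) = ∑ g ∈ levelings K Finset.univ,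
      levelWeight (MvPolynomial.X 0 - MvPolynomial.X 1 : AlphaT) (MvPolynomial.X 1)
        Finset.univ g := by
  have hV : 0 < Fintype.card V := Fintype.card_pos_iff.2 ⟨hK.choose⟩
  rw [hPoly, fPoly, convDim_sum_simplexOn_of_mem_iff hK hB, map_sum,
    ← Finset.sum_fiberwise_of_maps_to (s := levelings K Finset.univ)
      (t := Finset.range (Fintype.card V - 1 + 1))
      (g := fun g => (levelSupport g).card - height g)]
  · refine Finset.sum_congr rfl fun i _ => ?_
    rw [faceCount_eq_card hK hB, Finset.sum_congr rfl (g := fun _ =>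
      (MvPolynomial.X 0 - MvPolynomial.X 1 : AlphaT) ^ i *
        MvPolynomial.X 1 ^ (Fintype.card V - 1 - i)), Finset.sum_const, nsmul_eq_mul]
    · simp [mul_assoc]
    · intro g hg
      obtain ⟨hgK, rfl⟩ := Finset.mem_filter.1 hg
      have h1 := (mem_levelings.1 hgK).one_le_height
      have h2 := (mem_levelings.1 hgK).height_le_card
      have h3 := Finset.card_le_univ (levelSupport g)
      rw [levelWeight, Finset.card_univ, show Fintype.card V - 1 - ((levelSupport g).card - height g)
        = Fintype.card V - (levelSupport g).card + height g - 1 by omega]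
  · intro g hg
    have h1 := (mem_levelings.1 hg).one_le_height
    have h3 := Finset.card_le_univ (levelSupport g)
    rw [Finset.mem_range]
    omega

/-- For a = α - t the generators a + 2t and t(a + t) become α + t and αt. -/
theorem hPoly_sum_simplexOn_mem_galCone (hK : K.Nonempty)
    (hB : ∀ S, S ∈ B ↔ (S ∩ K).Nonempty ∨ ∃ v, S = {v}) :
    hPoly (∑ S ∈ B, simplexOn S) ∈ galCone (MvPolynomial.X 0 + MvPolynomial.X 1 : AlphaT)
      (MvPolynomial.X 0 * MvPolynomial.X 1) (convDim (∑ S ∈ B, simplexOn S)) := by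
  have hV : 1 ≤ Fintype.card V := Fintype.card_pos_iff.2 ⟨hK.choose⟩
  have h := sum_levelWeight_mem_galCone
    (MvPolynomial.X 0 - MvPolynomial.X 1 : AlphaT) (MvPolynomial.X 1) K Finset.univ
  rw [← hPoly_sum_simplexOn hK hB] at h
  rw [convDim_sum_simplexOn_of_mem_iff hK hB]
  convert h using 1
  congr 1
  · ring
  · ring
  · rw [Finset.card_univ]
    push_cast [hV]
    ring

end Faces

/-! ### From the Gal cone to γ-vectors -/

section GammaVector

/-- In degree n the exponent j of b determines that of a as n - 2j, so collecting generators by j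
gives the γ-vector. -/
theorem exists_sum_eq_of_mem_galCone {R : Type*} [CommRing R] {a b x : R} {n : ℕ}
    (hx : x ∈ galCone a b n) :
    ∃ γ : Fin (n / 2 + 1) → ℕ,
      x = ∑ i : Fin (n / 2 + 1), (γ i : R) * b ^ (i : ℕ) * a ^ (n - 2 * (i : ℕ)) := by
  induction hx using AddSubmonoid.closure_induction with
  | zero => exact ⟨0, by simp⟩
  | add x y _ _ hx hy =>
    obtain ⟨γ, rfl⟩ := hx
    obtain ⟨δ, rfl⟩ := hy
    refine ⟨γ + δ, ?_⟩
    rw [← Finset.sum_add_distrib]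
    refine Finset.sum_congr rfl fun i _ => ?_
    rw [Pi.add_apply]
    push_cast
    ring
  | mem x hx =>
    obtain ⟨i, j, hij, rfl⟩ := hx
    refine ⟨Pi.single ⟨j, by omega⟩ 1, ?_⟩
    rw [Finset.sum_eq_single (⟨j, by omega⟩ : Fin (n / 2 + 1))]
    · rw [Pi.single_eq_same, show n - 2 * j = i by omega]
      push_cast
      ring
    · intro k _ hk
      rw [Pi.single_eq_of_ne hk]
      simp
    · exact fun h => absurd (Finset.mem_univ _) h

theorem isHomogeneous_of_mem_galCone {p : AlphaT} {n : ℕ}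
    (hp : p ∈ galCone (MvPolynomial.X 0 + MvPolynomial.X 1 : AlphaT)
      (MvPolynomial.X 0 * MvPolynomial.X 1) n) : p.IsHomogeneous n := by
  induction hp using AddSubmonoid.closure_induction with
  | zero => exact MvPolynomial.isHomogeneous_zero _ _ _
  | add x y _ _ hx hy => exact hx.add hy
  | mem x hx =>
    obtain ⟨i, j, hij, rfl⟩ := hx
    have h := (((MvPolynomial.isHomogeneous_X ℚ (0 : Fin 2)).add
      (MvPolynomial.isHomogeneous_X ℚ 1)).pow i).mul
      (((MvPolynomial.isHomogeneous_X ℚ (0 : Fin 2)).mul (MvPolynomial.isHomogeneous_X ℚ 1)).pow j)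
    rwa [show 1 * i + (1 + 1) * j = n by omega] at h

theorem exists_aeval_eq_of_mem_galCone {p : AlphaT} {n : ℕ}
    (hp : p ∈ galCone (MvPolynomial.X 0 + MvPolynomial.X 1 : AlphaT)
      (MvPolynomial.X 0 * MvPolynomial.X 1) n) :
    ∃ q : MvPolynomial (Fin 2) ℚ, MvPolynomial.aeval
      ![(MvPolynomial.X 0 + MvPolynomial.X 1 : AlphaT), MvPolynomial.X 0 * MvPolynomial.X 1] q = p ∧
      ∀ e, 0 ≤ MvPolynomial.coeff e q := by
  induction hp using AddSubmonoid.closure_induction with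
  | zero => exact ⟨0, by simp, by simp⟩
  | add x y _ _ hx hy =>
    obtain ⟨q, rfl, hq⟩ := hx
    obtain ⟨r, rfl, hr⟩ := hy
    exact ⟨q + r, map_add _ _ _, fun e => by
      rw [MvPolynomial.coeff_add]
      exact add_nonneg (hq e) (hr e)⟩
  | mem x hx =>
    obtain ⟨i, j, -, rfl⟩ := hx
    refine ⟨MvPolynomial.monomial (Finsupp.single 0 i + Finsupp.single 1 j) 1, ?_, fun e => ?_⟩
    · rw [← one_mul (1 : ℚ), ← MvPolynomial.monomial_mul, ← MvPolynomial.X_pow_eq_monomial,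
        ← MvPolynomial.X_pow_eq_monomial]
      simp
    · rw [MvPolynomial.coeff_monomial]
      split_ifs <;> norm_num

theorem exists_isGammaVector_of_mem_galCone {V : Type} {P : Set (V → ℝ)}
    (hP : hPoly P ∈ galCone (MvPolynomial.X 0 + MvPolynomial.X 1 : AlphaT)
      (MvPolynomial.X 0 * MvPolynomial.X 1) (convDim P)) :
    ∃ γ : Fin (convDim P / 2 + 1) → ℤ, IsGammaVector P γ ∧ ∀ i, 0 ≤ γ i := by
  obtain ⟨γ, hγ⟩ := exists_sum_eq_of_mem_galCone hP
  refine ⟨fun i => γ i, ?_, fun i => Int.natCast_nonneg _⟩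
  rw [IsGammaVector, hγ]
  simp

end GammaVector

/-! ### The join of a complete and an empty graph -/

section JoinNestohedron

theorem SimpleGraph.mem_buildingSet_iff {V : Type} [Fintype V] [DecidableEq V]
    (G : SimpleGraph V) {S : Finset V} :
    S ∈ G.buildingSet.sets ↔ S.Nonempty ∧ (G.induce (S : Set V)).Connected := by
  simp [SimpleGraph.buildingSet]

/-- A clique node is adjacent to all other nodes, whereas nodes outside the clique are pairwise
non-adjacent. -/
theorem mem_buildingSet_join_iff {k l : ℕ} {S : Finset (Fin k ⊕ Fin l)} :
    S ∈ (SimpleGraph.joinGraph (⊤ : SimpleGraph (Fin k))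
      (⊥ : SimpleGraph (Fin l))).buildingSet.sets ↔
      (S ∩ Finset.univ.map Function.Embedding.inl).Nonempty ∨ ∃ v, S = {v} := by
  constructor
  · intro h
    obtain ⟨⟨v, hv⟩, hconn⟩ := (SimpleGraph.mem_buildingSet_iff _).1 h
    by_contra! hcon
    obtain ⟨hK, hS⟩ := hcon
    have hinl : ∀ i, Sum.inl i ∉ S := fun i hi =>
      (Finset.notMem_empty (Sum.inl i : Fin k ⊕ Fin l))
        (hK ▸ Finset.mem_inter.2 ⟨hi, Finset.mem_map.2 ⟨i, Finset.mem_univ i, rfl⟩⟩)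
    obtain ⟨w, hw, hwv⟩ : ∃ w ∈ S, w ≠ v := by
      by_contra! hall
      exact hS v (Finset.eq_singleton_iff_unique_mem.2 ⟨hv, hall⟩)
    have : Nontrivial (S : Set (Fin k ⊕ Fin l)) :=
      ⟨⟨⟨w, hw⟩, ⟨v, hv⟩, fun h => hwv (congrArg Subtype.val h)⟩⟩
    obtain ⟨⟨u, hu⟩, huv⟩ := hconn.preconnected.exists_adj_of_nontrivial ⟨v, hv⟩
    rw [SimpleGraph.comap_adj] at huv
    rcases v with i | i
    · exact hinl i hv
    · rcases u with j | j
      · exact hinl j hu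
      · simp [SimpleGraph.joinGraph] at huv
  · rintro (⟨v, hv⟩ | ⟨v, rfl⟩)
    · obtain ⟨hvS, hvK⟩ := Finset.mem_inter.1 hv
      obtain ⟨i, -, rfl⟩ := Finset.mem_map.1 hvK
      refine (SimpleGraph.mem_buildingSet_iff _).2 ⟨⟨_, hvS⟩, ?_⟩
      rw [SimpleGraph.connected_iff_exists_forall_reachable]
      refine ⟨⟨_, hvS⟩, fun ⟨w, hw⟩ => ?_⟩
      by_cases hwi : w = Sum.inl i
      · subst hwi
        exact SimpleGraph.Reachable.refl _
      · refine SimpleGraph.Adj.reachable ?_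
        rw [SimpleGraph.comap_adj]
        rcases w with j | j
        · have : i ≠ j := fun h => hwi (by rw [h])
          simp [SimpleGraph.joinGraph, this]
        · simp [SimpleGraph.joinGraph]
    · exact BuildingSet.singleton_mem _ v

theorem convDim_joinNestohedron {k : ℕ} (hk : 1 ≤ k) (l : ℕ) :
    convDim (joinNestohedron k l) = k + l - 1 := by
  have : NeZero k := ⟨by omega⟩
  rw [joinNestohedron, nestohedron, convDim_sum_simplexOn_of_mem_iff
    ((Finset.univ_nonempty (α := Fin k)).map) fun S => mem_buildingSet_join_iff]
  simp

theorem hPoly_joinNestohedron_mem_galCone (k l : ℕ) :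
    hPoly (joinNestohedron k l) ∈ galCone (MvPolynomial.X 0 + MvPolynomial.X 1 : AlphaT)
      (MvPolynomial.X 0 * MvPolynomial.X 1) (convDim (joinNestohedron k l)) := by
  obtain rfl | hk := k.eq_zero_or_pos
  -- Without clique nodes only singletons are connected, so the polytope is a sum of points and h =
  -- 1.
  · have hB : ∀ S : Finset (Fin 0 ⊕ Fin l), S ∈ (SimpleGraph.joinGraph
        (⊤ : SimpleGraph (Fin 0)) (⊥ : SimpleGraph (Fin l))).buildingSet.sets ↔ ∃ v, S = {v} :=
      fun S => by simp [mem_buildingSet_join_iff]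
    obtain ⟨x, hx⟩ : ∃ x, joinNestohedron 0 l = {x} := by
      refine ⟨∑ S ∈ (SimpleGraph.joinGraph (⊤ : SimpleGraph (Fin 0))
        (⊥ : SimpleGraph (Fin l))).buildingSet.sets, ∑ v ∈ S, Pi.single v 1, ?_⟩
      have hpt : ∀ S ∈ (SimpleGraph.joinGraph (⊤ : SimpleGraph (Fin 0))
          (⊥ : SimpleGraph (Fin l))).buildingSet.sets, simplexOn S = {∑ v ∈ S, Pi.single v 1} := by
        intro S hS
        obtain ⟨v, rfl⟩ := (hB S).1 hS
        simp [simplexOn]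
      rw [joinNestohedron, nestohedron, Finset.sum_congr rfl hpt, Set.finsetSum_singleton]
    have hdim : convDim (joinNestohedron 0 l) = 0 := by
      rw [hx, convDim, vectorSpan_singleton, finrank_bot]
    have hcount : faceCount (joinNestohedron 0 l) 0 = 1 := by
      rw [faceCount, Set.ncard_eq_one]
      refine ⟨joinNestohedron 0 l, Set.eq_singleton_iff_unique_mem.2
        ⟨⟨hx ▸ Set.singleton_nonempty x, IsExposed.refl _, hdim⟩, ?_⟩⟩
      rintro F ⟨hF, hexp, -⟩
      have := hexp.subset
      rw [hx] at this ⊢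
      exact hF.subset_singleton_iff.1 this
    rw [hPoly, fPoly, hdim]
    simpa [hcount] using pow_mul_pow_mem_galCone (MvPolynomial.X 0 + MvPolynomial.X 1 : AlphaT)
      (MvPolynomial.X 0 * MvPolynomial.X 1) 0 0
  · have : NeZero k := ⟨by omega⟩
    rw [joinNestohedron, nestohedron]
    exact hPoly_sum_simplexOn_mem_galCone ((Finset.univ_nonempty (α := Fin k)).map)
      fun S => mem_buildingSet_join_iff

theorem isSymmetricSeries_substAB (ψ : MvPowerSeries (Fin 2) (MvPolynomial (Fin 2) ℚ)) :
    IsSymmetricSeries (substAB ψ) := by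
  rw [IsSymmetricSeries, substAB, ← RingHom.comp_apply, ← MvPowerSeries.map_comp]
  congr 2
  refine MvPolynomial.ringHom_ext (fun r => by simp) fun i => ?_
  fin_cases i
  · simp [add_comm]
  · simp [mul_comm]

theorem isGalSeries_joinSeries : IsGalSeries joinSeries := by
  have hcoeff : ∀ m, MvPowerSeries.coeff m joinSeries = if 1 ≤ m 0 then
      MvPolynomial.C (1 / ((m 0).factorial * (m 1).factorial : ℚ)) *
        hPoly (joinNestohedron (m 0) (m 1)) else 0 := fun m => rfl
  have hlift : ∃ ψ' : MvPowerSeries (Fin 2) (MvPolynomial (Fin 2) ℚ), substAB ψ' = joinSeries ∧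
      ∀ m e : Fin 2 →₀ ℕ, 0 ≤ MvPolynomial.coeff e (MvPowerSeries.coeff m ψ') := by
    choose q hq hq0 using fun k l =>
      exists_aeval_eq_of_mem_galCone (hPoly_joinNestohedron_mem_galCone k l)
    obtain ⟨ψ', hψ'⟩ : ∃ ψ' : MvPowerSeries (Fin 2) (MvPolynomial (Fin 2) ℚ), ∀ m,
        MvPowerSeries.coeff m ψ' = if 1 ≤ m 0 then
          MvPolynomial.C (1 / ((m 0).factorial * (m 1).factorial : ℚ)) * q (m 0) (m 1) else 0 :=
      ⟨fun m => if 1 ≤ m 0 then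
        MvPolynomial.C (1 / ((m 0).factorial * (m 1).factorial : ℚ)) * q (m 0) (m 1) else 0,
        fun m => rfl⟩
    refine ⟨ψ', ?_, fun m e => ?_⟩
    · ext1 m
      rw [hcoeff, substAB, MvPowerSeries.coeff_map, hψ']
      split_ifs
      · rw [← hq (m 0) (m 1)]
        simp
      · simp
    · rw [hψ']
      split_ifs
      · rw [MvPolynomial.coeff_C_mul]
        exact mul_nonneg (by positivity) (hq0 _ _ _)
      · simp
  -- The dimension k + l - 1 is one less than the degree k + l in x and y; doubled, this gives the
  -- degree 2.
  refine ⟨?_, ⟨2, fun m e he => ?_⟩, hlift⟩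
  · obtain ⟨ψ', h, -⟩ := hlift
    rw [← h]
    exact isSymmetricSeries_substAB ψ'
  · rw [hcoeff] at he
    split_ifs at he with hm
    · rw [MvPolynomial.coeff_C_mul] at he
      have h := isHomogeneous_of_mem_galCone (hPoly_joinNestohedron_mem_galCone (m 0) (m 1))
        (right_ne_zero_of_mul he)
      rw [convDim_joinNestohedron hm] at h
      simp [Finsupp.weight_apply, Finsupp.sum_fintype] at h
      omega
    · simp at he

end JoinNestohedron

theorem mainTheorem4 :
    IsGalSeries joinSeries ∧
      ∀ k l : ℕ, ∃ γ : Fin (convDim (joinNestohedron k l) / 2 + 1) → ℤ,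
        IsGammaVector (joinNestohedron k l) γ ∧ ∀ i, 0 ≤ γ i :=
  ⟨isGalSeries_joinSeries, fun k l =>
    exists_isGammaVector_of_mem_galCone (hPoly_joinNestohedron_mem_galCone k l)⟩
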